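/- Let $r$ be a natural number and let $S$ be an integral domain with parameters $\rho, q, \delta_j\ (j\ge 0), u_1,\dots,u_r\in S$ such that $\rho, q, \delta_0, u_1,\dots,u_r$ are invertible in $S$ and $\rho^{-1}-\rho=(q^{-1}-q)(\delta_0-1)$. Assume $q-q^{-1}\neq 0$, that the $u_i$ are distinct, and that $u_iu_j\ne 1$ for all $i,j$ (including $i=j$). Let $W_2$ be the two-strand cyclotomic BMW algebra over $S$: the unital associative $S$-algebra with generators $y_1^{\pm1}, g^{\pm1}, e$ and relations $gg^{-1}=g^{-1}g=1$, $y_1y_1^{-1}=y_1^{-1}y_1=1$; $e^2=\delta_0e$; $y_1gy_1g=gy_1gy_1$; $e y_1^{j}e=\delta_je$ for $j\ge1$; $g-g^{-1}=(q-q^{-1})(1-e)$; $ge=eg=\rho^{-1}e$; $e y_1gy_1=\rho e=y_1gy_1e$; and $(y_1-u_1)\cdots(y_1-u_r)=0$. Define $\delta_{-j}\in S$ for $j\ge1$ recursively by $$\delta_{-j}=\rho^{-2}\delta_j+(q^{-1}-q)\rho^{-1}\sum_{k=1}^{j-1}(\delta_k\delta_{k-j}-\delta_{2k-j})$$ (so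 $\delta_{-1}=\rho^{-2}\delta_1$). Call $S$ weakly admissible if $\sum_{k=0}^r(-1)^{r-k}\varepsilon_{r-k}(u_1,\dots,u_r)\,\delta_{k+a}=0$ for all $a\in\mathbb Z$, where $\varepsilon_j$ is the $j$-th elementary symmetric function. For $1\le j\le r$ define, in the field of fractions of $S$, $$\gamma_j=\prod_{\ell\ne j}\frac{u_\ell u_j-1}{u_j-u_\ell}\left(\frac{1-u_j^2}{\rho(q^{-1}-q)}\prod_{\ell\neq j}u_\ell+\begin{cases}1&\text{if } r \text{ is odd}\\-u_j&\text{if } r\text{ is even}\end{cases}\right).$$ Then the following conditions are equivalent: 1. $S$ is weakly admissible, and $e, y_1e,\dots,y_1^{r-1}e$ are linearly independent over $S$ in $W_2$. 2. For all $a\ge0$, $\delta_a=\sum_{j=1}^r\gamma_ju_j^a$. 3. $S$ is weakly admissible, and $W_2$ admits a (left) module $M$ with an $S$-basis $\{v_0,y_1v_0,\dots,y_1^{r-1}v_0\}$ such that $ev_0=\delta_0v_0$. -/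

import Mathlib

/-- The parameters `ρ`, `q`, `δ_j` (`j ≥ 0`), `u_1, …, u_r` that make a commutative ring `S` into
a ground ring: `ρ`, `q`, `δ_0` and the `u_i` are invertible and
`ρ⁻¹ - ρ = (q⁻¹ - q) (δ_0 - 1)`. The parameter `u_{i+1}` is `u i`, for `i : Fin r`. -/
structure GroundParams (S : Type*) [CommRing S] (r : ℕ) where
  ρ : Sˣ
  q : Sˣ
  δ : ℕ → S
  u : Fin r → Sˣ
  isUnit_δ_zero : IsUnit (δ 0)
  relation : ((ρ⁻¹ : Sˣ) : S) - (ρ : S) = (((q⁻¹ : Sˣ) : S) - (q : S)) * (δ 0 - 1)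

/-- Generators of the cyclotomic BMW algebra on `n` strands (`n ≥ 1`): `y_1^{±1}`, and
`g_i^{±1}`, `e_i` for `1 ≤ i ≤ n - 1`. The index `i` is represented by the element of
`Fin (n - 1)` with value `i - 1`. -/
inductive BMWGen (n : ℕ) : Type
  | y : BMWGen n
  | yInv : BMWGen n
  | g (i : Fin (n - 1)) : BMWGen n
  | gInv (i : Fin (n - 1)) : BMWGen n
  | e (i : Fin (n - 1)) : BMWGen n

namespace BMWGen

/-- Indices that differ by exactly one. -/
def Adjacent {n : ℕ} (i j : Fin (n - 1)) : Prop :=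
  i.val + 1 = j.val ∨ j.val + 1 = i.val

/-- Indices that differ by at least two. -/
def Far {n : ℕ} (i j : Fin (n - 1)) : Prop :=
  i.val + 2 ≤ j.val ∨ j.val + 2 ≤ i.val

end BMWGen

namespace GroundParams

universe u

variable {S : Type*} [CommRing S] {r : ℕ}

/-- The generators as elements of the free algebra. -/
abbrev freeGen (S : Type*) [CommRing S] {n : ℕ} (x : BMWGen n) : FreeAlgebra S (BMWGen n) :=
  FreeAlgebra.ι S x

open BMWGen in
/-- The defining relations of the cyclotomic BMW algebra. -/
inductive BMWRel (P : GroundParams S r) (n : ℕ) :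
    FreeAlgebra S (BMWGen n) → FreeAlgebra S (BMWGen n) → Prop
  -- inverses
  | g_mul_gInv (i : Fin (n - 1)) : BMWRel P n (freeGen S (g i) * freeGen S (gInv i)) 1
  | gInv_mul_g (i : Fin (n - 1)) : BMWRel P n (freeGen S (gInv i) * freeGen S (g i)) 1
  | y_mul_yInv : BMWRel P n (freeGen S y * freeGen S yInv) 1
  | yInv_mul_y : BMWRel P n (freeGen S yInv * freeGen S y) 1
  -- idempotent relation
  | e_sq (i : Fin (n - 1)) :
      BMWRel P n (freeGen S (e i) * freeGen S (e i)) (P.δ 0 • freeGen S (e i))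
  -- affine braid relations
  | braid (i j : Fin (n - 1)) (h : i.val + 1 = j.val) :
      BMWRel P n (freeGen S (g i) * freeGen S (g j) * freeGen S (g i))
        (freeGen S (g j) * freeGen S (g i) * freeGen S (g j))
  | g_comm (i j : Fin (n - 1)) (h : Far i j) :
      BMWRel P n (freeGen S (g i) * freeGen S (g j)) (freeGen S (g j) * freeGen S (g i))
  | braid_y (i : Fin (n - 1)) (h : i.val = 0) :
      BMWRel P n (freeGen S y * freeGen S (g i) * freeGen S y * freeGen S (g i))
        (freeGen S (g i) * freeGen S y * freeGen S (g i) * freeGen S y)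
  | y_g_comm (j : Fin (n - 1)) (h : 1 ≤ j.val) :
      BMWRel P n (freeGen S y * freeGen S (g j)) (freeGen S (g j) * freeGen S y)
  -- commutation relations
  | g_e_comm (i j : Fin (n - 1)) (h : Far i j) :
      BMWRel P n (freeGen S (g i) * freeGen S (e j)) (freeGen S (e j) * freeGen S (g i))
  | e_comm (i j : Fin (n - 1)) (h : Far i j) :
      BMWRel P n (freeGen S (e i) * freeGen S (e j)) (freeGen S (e j) * freeGen S (e i))
  | y_e_comm (j : Fin (n - 1)) (h : 1 ≤ j.val) :
      BMWRel P n (freeGen S y * freeGen S (e j)) (freeGen S (e j) * freeGen S y)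
  -- affine tangle relations
  | e_e_e (i j : Fin (n - 1)) (h : Adjacent i j) :
      BMWRel P n (freeGen S (e i) * freeGen S (e j) * freeGen S (e i)) (freeGen S (e i))
  | g_g_e (i j : Fin (n - 1)) (h : Adjacent i j) :
      BMWRel P n (freeGen S (g i) * freeGen S (g j) * freeGen S (e i))
        (freeGen S (e j) * freeGen S (e i))
  | e_g_g (i j : Fin (n - 1)) (h : Adjacent i j) :
      BMWRel P n (freeGen S (e i) * freeGen S (g j) * freeGen S (g i))
        (freeGen S (e i) * freeGen S (e j))
  | e_y_pow_e (i : Fin (n - 1)) (h : i.val = 0) (k : ℕ) (hk : 1 ≤ k) :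
      BMWRel P n (freeGen S (e i) * freeGen S y ^ k * freeGen S (e i))
        (P.δ k • freeGen S (e i))
  -- Kauffman skein relation
  | skein (i : Fin (n - 1)) :
      BMWRel P n (freeGen S (g i) - freeGen S (gInv i))
        (((P.q : S) - ((P.q⁻¹ : Sˣ) : S)) • (1 - freeGen S (e i)))
  -- untwisting relations
  | g_e (i : Fin (n - 1)) :
      BMWRel P n (freeGen S (g i) * freeGen S (e i)) (((P.ρ⁻¹ : Sˣ) : S) • freeGen S (e i))
  | e_g (i : Fin (n - 1)) :
      BMWRel P n (freeGen S (e i) * freeGen S (g i)) (((P.ρ⁻¹ : Sˣ) : S) • freeGen S (e i))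
  | e_g_e (i j : Fin (n - 1)) (h : Adjacent i j) :
      BMWRel P n (freeGen S (e i) * freeGen S (g j) * freeGen S (e i))
        ((P.ρ : S) • freeGen S (e i))
  -- unwrapping relation
  | e_unwrap (i : Fin (n - 1)) (h : i.val = 0) :
      BMWRel P n (freeGen S (e i) * freeGen S y * freeGen S (g i) * freeGen S y)
        ((P.ρ : S) • freeGen S (e i))
  | unwrap_e (i : Fin (n - 1)) (h : i.val = 0) :
      BMWRel P n (freeGen S y * freeGen S (g i) * freeGen S y * freeGen S (e i))
        ((P.ρ : S) • freeGen S (e i))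
  -- cyclotomic relation
  | cyclotomic :
      BMWRel P n
        (List.ofFn fun k : Fin r =>
          freeGen S y - algebraMap S (FreeAlgebra S (BMWGen n)) (P.u k : S)).prod 0

/-- The cyclotomic BMW algebra on `n` strands with the given parameters. -/
abbrev CycBMW (P : GroundParams S r) (n : ℕ) : Type _ :=
  RingQuot (P.BMWRel n)

/-- The image of a generator in the cyclotomic BMW algebra. -/
noncomputable def gen (P : GroundParams S r) {n : ℕ} (x : BMWGen n) : P.CycBMW n :=
  RingQuot.mkAlgHom S (P.BMWRel n) (FreeAlgebra.ι S x)

/-- The two-strand algebra `W_2`. -/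
abbrev W₂ (P : GroundParams S r) : Type _ := P.CycBMW 2

/-- The element `y_1` of `W_2`. -/
noncomputable def y₁ (P : GroundParams S r) : P.W₂ := P.gen BMWGen.y

/-- The element `e = e_1` of `W_2`. -/
noncomputable def e₁ (P : GroundParams S r) : P.W₂ := P.gen (BMWGen.e ⟨0, Nat.one_pos⟩)

/-- `deltaNeg j` is `δ_{-j}`. The summation index `k : Fin j` stands for `k + 1` in the
recursion formula that is proved in `deltaInt_neg` below. -/
noncomputable def deltaNeg (P : GroundParams S r) : ℕ → S
  | 0 => P.δ 0
  | j + 1 => ((P.ρ⁻¹ : Sˣ) : S) ^ 2 * P.δ (j + 1) +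
      (((P.q⁻¹ : Sˣ) : S) - (P.q : S)) * ((P.ρ⁻¹ : Sˣ) : S) *
        ∑ k : Fin j, (P.δ (k.val + 1) * deltaNeg P (j - k.val) -
          if j ≤ 2 * k.val + 1 then P.δ (2 * k.val + 1 - j) else deltaNeg P (j - (2 * k.val + 1)))
  termination_by j => j
  decreasing_by all_goals omega

/-- The elements `δ_a` for all integers `a`. -/
noncomputable def deltaInt (P : GroundParams S r) (a : ℤ) : S :=
  if 0 ≤ a then P.δ a.toNat else P.deltaNeg (-a).toNat

theorem deltaInt_natCast (P : GroundParams S r) (j : ℕ) : P.deltaInt (j : ℤ) = P.δ j := by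
  simp [deltaInt]

/-- The recursion that determines the `δ_{-j}`, `j ≥ 1` (for `j = 1` it reads
`δ_{-1} = ρ^{-2} δ_1`). -/
theorem deltaInt_neg (P : GroundParams S r) (j : ℕ) (hj : 1 ≤ j) :
    P.deltaInt (-(j : ℤ)) = ((P.ρ⁻¹ : Sˣ) : S) ^ 2 * P.deltaInt j +
      (((P.q⁻¹ : Sˣ) : S) - (P.q : S)) * ((P.ρ⁻¹ : Sˣ) : S) *
        ∑ k ∈ Finset.Icc 1 (j - 1),
          (P.deltaInt k * P.deltaInt ((k : ℤ) - j) - P.deltaInt (2 * (k : ℤ) - j)) := by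
  obtain ⟨m, rfl⟩ : ∃ m, j = m + 1 := ⟨j - 1, by omega⟩
  have hneg : ¬ (0 : ℤ) ≤ -((m + 1 : ℕ) : ℤ) := by omega
  have hto : (- -((m + 1 : ℕ) : ℤ)).toNat = m + 1 := by omega
  rw [deltaInt, if_neg hneg, hto, deltaNeg, deltaInt_natCast]
  congr 2
  rw [Nat.add_sub_cancel]
  refine Finset.sum_bij (fun k _ => k.val + 1) (fun k _ => ?_) (fun a _ b _ h => ?_)
    (fun b hb => ?_) (fun k _ => ?_)
  · have := k.isLt
    simp only [Finset.mem_Icc]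
    omega
  · exact Fin.ext (by omega)
  · simp only [Finset.mem_Icc] at hb
    exact ⟨⟨b - 1, by omega⟩, Finset.mem_univ _, by simp only; omega⟩
  · have hk := k.isLt
    have h1 : P.deltaInt (((k.val + 1 : ℕ) : ℤ) - ((m + 1 : ℕ) : ℤ)) =
        P.deltaNeg (m - k.val) := by
      rw [deltaInt, if_neg (by omega)]
      congr 1
      omega
    have h2 : P.deltaInt (2 * ((k.val + 1 : ℕ) : ℤ) - ((m + 1 : ℕ) : ℤ)) =
        if m ≤ 2 * k.val + 1 then P.δ (2 * k.val + 1 - m)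
          else P.deltaNeg (m - (2 * k.val + 1)) := by
      rw [deltaInt]
      split_ifs
      · congr 1
        omega
      · omega
      · omega
      · congr 1
        omega
    rw [h1, h2, deltaInt_natCast]

/-- Weak admissibility of the parameters. -/
def WeaklyAdmissible (P : GroundParams S r) : Prop :=
  ∀ a : ℤ, ∑ k ∈ Finset.range (r + 1),
    (-1) ^ (r - k) * (Finset.univ.val.map fun i : Fin r => (P.u i : S)).esymm (r - k) *
      P.deltaInt ((k : ℤ) + a) = 0

/-- `W_2` has a (left) module `M` with an `S`-basis `v_0, y_1 v_0, …, y_1^{r-1} v_0` such that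
`e v_0 = δ_0 v_0`. The scalar tower says that `S` acts on `M` through `W_2`. -/
def HasCyclicModule {S : Type u} [CommRing S] (P : GroundParams S r) : Prop :=
  ∃ (M : Type u) (_ : AddCommGroup M) (_ : Module S M) (_ : Module P.W₂ M)
    (_ : IsScalarTower S P.W₂ M) (v₀ : M) (b : Module.Basis (Fin r) S M),
    (∀ k : Fin r, b k = P.y₁ ^ k.val • v₀) ∧ P.e₁ • v₀ = P.δ 0 • v₀

/-- The elements `γ_j` of the field of fractions `K` of `S`. -/
noncomputable def gamma (P : GroundParams S r) (K : Type*) [Field K] [Algebra S K]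
    (j : Fin r) : K :=
  let u : Fin r → K := fun l => algebraMap S K (P.u l)
  let ρ : K := algebraMap S K P.ρ
  let q : K := algebraMap S K P.q
  (∏ l ∈ Finset.univ.erase j, (u l * u j - 1) / (u j - u l)) *
    ((1 - u j ^ 2) / (ρ * (q⁻¹ - q)) * (∏ l ∈ Finset.univ.erase j, u l) +
      if Odd r then 1 else -u j)

end GroundParams

/-! Write z = q - q⁻¹. All three conditions revolve around one linear system with a Cauchy matrix,
∑_j x_j / (u_i u_j - 1) = 1 / (u_i² - 1) + ρ⁻¹ / z. It has exactly one solution over K, namely x = γ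
(`sum_cauchySolution_div`, `eq_cauchySolution`, `gamma_eq_cauchySolution`).

1 → 3: the module is the left ideal W_2 e. The relation for y g y^(k+1) e
(`y₁_mul_g₁_mul_y₁_pow_succ_mul_e₁`) shows that the span of e, …, y^(r-1) e is stable under g, hence
under W_2.

3 → 2: M is S[X]/∏(X - u_i) as a y-module, so evaluation at u_i is a functional χ_i on M. Applying
χ_i to the same relation gives a recursion for p ↦ χ_i(g p(y) v_0). On the Lagrange polynomials
∏_{l≠j}(X - u_l) multiplication by X acts as u_j, and the recursion can be solved there. Together
with g v_0 = ρ⁻¹ v_0 this is the Cauchy system for the Lagrange coordinates x_j of the functional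
X^k ↦ δ_k. Weak admissibility says that this functional factors through the quotient, so δ_a = ∑ x_j
u_j^a with x = γ.

2 → 1: matrices over K on an eigenbasis of y represent W_2: y is diagonal, every row of e is γ, and
g has entries z(γ_j - δ_ij)/(u_i u_j - 1), with Kronecker δ_ij. The Cauchy system says that the rows
of g sum to ρ⁻¹; the other relations follow from it, the ground relation and condition 2. A
Vandermonde argument then gives linear independence. The recursion for δ_{-j} is read off from g as
well, so δ_a = ∑ γ_j u_j^a for all integers a, and weak admissibility follows. -/

/-! ### Cauchy systems via Lagrange interpolation. -/

open Polynomial in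
theorem Polynomial.natDegree_prod_C_mul_X_sub_one_le {K ι : Type*} [CommRing K] (s : Finset ι)
    (u : ι → K) : (∏ l ∈ s, (C (u l) * X - 1)).natDegree ≤ s.card := by
  refine (natDegree_prod_le _ _).trans
    ((Finset.sum_le_card_nsmul _ _ 1 fun l _ => ?_).trans (by simp))
  rw [← C_1]
  exact (natDegree_sub_C).trans_le (natDegree_C_mul_le _ _) |>.trans natDegree_X_le

open Polynomial in
-- Interpolate ∏_{l≠i}(u_l X - 1), of degree below r, at the nodes u_j and evaluate at 0; both sides
-- carry the sign (-1)^(r-1).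
theorem Lagrange.sum_prod_mul_sub_one_mul_prod_div {K : Type*} [Field K] {r : ℕ} {u : Fin r → K}
    (hu : Function.Injective u) (i : Fin r) :
    ∑ j, (∏ l ∈ Finset.univ.erase i, (u l * u j - 1)) *
      (∏ l ∈ Finset.univ.erase j, u l / (u j - u l)) = 1 := by
  classical
  set p : K[X] := ∏ l ∈ Finset.univ.erase i, (C (u l) * X - 1) with hp
  have hcard (j : Fin r) : (Finset.univ.erase j).card = r - 1 := by simp
  have hdeg : p.degree < (Finset.univ : Finset (Fin r)).card := by
    have h1 : p.natDegree ≤ r - 1 := (natDegree_prod_C_mul_X_sub_one_le _ u).trans_eq (hcard i)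
    have := i.pos
    refine lt_of_le_of_lt degree_le_natDegree ?_
    rw [Finset.card_univ, Fintype.card_fin]
    exact_mod_cast (by omega : p.natDegree < r)
  have h := congrArg (eval 0) (Lagrange.eq_interpolate (s := Finset.univ) (v := u) hu.injOn hdeg)
  rw [Lagrange.interpolate_eq_sum, eval_finsetSum] at h
  have hev (x : K) : p.eval x = ∏ l ∈ Finset.univ.erase i, (u l * x - 1) := by
    simp [hp, eval_prod]
  have h0 : ((-1 : K)) ^ (r - 1) * (-1) ^ (r - 1) = 1 := by
    rw [← mul_pow]; simp
  calc _ = (-1 : K) ^ (r - 1) * ∑ j, eval 0 (C (eval (u j) p /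
          ∏ l ∈ Finset.univ.erase j, (u j - u l)) * ∏ l ∈ Finset.univ.erase j, (X - C (u l))) := by
        rw [Finset.mul_sum]
        refine Finset.sum_congr rfl fun j _ => ?_
        rw [eval_mul, eval_C, hev, eval_prod, Finset.prod_div_distrib]
        simp only [eval_sub, eval_X, eval_C, zero_sub]
        rw [Finset.prod_neg, hcard]
        linear_combination (-((∏ l ∈ Finset.univ.erase i, (u l * u j - 1)) *
          ((∏ l ∈ Finset.univ.erase j, u l) / (∏ l ∈ Finset.univ.erase j, (u j - u l))))) * h0
    _ = 1 := by
        rw [← h, hev]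
        simp [hcard, h0]

open Polynomial in
-- Factor by factor, uX - 1 = -X(X - u) + (X² - 1). Divisibility by X² - 1, unlike evaluation at ±1,
-- also serves in characteristic 2.
theorem Polynomial.X_sq_sub_one_dvd_prod_sub_prod {K ι : Type*} [CommRing K] (s : Finset ι)
    (u : ι → K) :
    (X ^ 2 - 1 : K[X]) ∣ ∏ l ∈ s, (C (u l) * X - 1) - (-X) ^ s.card * ∏ l ∈ s, (X - C (u l)) := by
  classical
  induction s using Finset.induction_on with
  | empty => simp
  | insert a s ha ih =>
    obtain ⟨w, hw⟩ := ih
    rw [Finset.prod_insert ha, Finset.prod_insert ha, Finset.card_insert_of_notMem ha]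
    rw [sub_eq_iff_eq_add] at hw
    rw [hw]
    refine ⟨(C (u a) * X - 1) * w + (-X) ^ s.card * ∏ l ∈ s, (X - C (u l)), ?_⟩
    ring

open Polynomial in
-- The sum is a leading coefficient in disguise. A monic `H` of degree r + 1, divisible by X² - 1,
-- takes the values (u_i² - 1) p(u_j) w(u_j) at the nodes. Its quotient by X² - 1 is monic of degree
-- r - 1, and Lagrange's formula for the top coefficient gives the identity.
theorem Lagrange.sum_prod_mul_sub_one_div {K : Type*} [Field K] {r : ℕ} {u : Fin r → K}
    (hu : Function.Injective u) (huu : ∀ i j, u i * u j ≠ 1) (i : Fin r) :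
    ∑ j, (∏ l ∈ Finset.univ.erase i, (u l * u j - 1)) * (if Odd r then 1 else -u j) /
      ((u j ^ 2 - 1) * ∏ l ∈ Finset.univ.erase j, (u j - u l)) = 1 / (u i ^ 2 - 1) := by
  classical
  have hne (j : Fin r) : u j ^ 2 - 1 ≠ 0 := by
    rw [sub_ne_zero, sq]; exact huu j j
  set p : K[X] := ∏ l ∈ Finset.univ.erase i, (C (u l) * X - 1) with hp
  set w : K[X] := if Odd r then 1 else -X with hw
  set N : K[X] := ∏ l, (X - C (u l)) with hN
  have hr := i.pos
  have hNm : N.Monic := monic_prod_of_monic _ _ fun l _ => monic_X_sub_C _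
  have hNd : N.natDegree = r := by
    rw [hN, natDegree_prod_of_monic _ _ fun l _ => monic_X_sub_C _]; simp
  have hpd : p.natDegree ≤ r - 1 :=
    (natDegree_prod_C_mul_X_sub_one_le _ u).trans_eq (by simp)
  have hwd : w.natDegree ≤ 1 := by rw [hw]; split_ifs <;> simp
  have hM : ((X + C (u i)) * N).Monic := (monic_X_add_C _).mul hNm
  have hMd : ((X + C (u i)) * N).natDegree = r + 1 := by
    rw [(monic_X_add_C _).natDegree_mul hNm, hNd, natDegree_X_add_C]; omega
  have hlt : (p * w * C (u i ^ 2 - 1)).degree < ((X + C (u i)) * N).degree := by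
    refine degree_lt_degree ?_
    rw [hMd]
    have := (natDegree_mul_C_le (p * w) (u i ^ 2 - 1)).trans natDegree_mul_le
    omega
  -- The first summand vanishes at all nodes; it makes `H` monic and cancels the second summand
  -- modulo X² - 1.
  set H : K[X] := (X + C (u i)) * N + p * w * C (u i ^ 2 - 1) with hH
  have hHm : H.Monic := hM.add_of_left hlt
  have hHd : H.natDegree = r + 1 := by
    rw [hH, natDegree_add_eq_left_of_degree_lt hlt, hMd]
  have hdvd : (X ^ 2 - 1 : K[X]) ∣ H := by
    obtain ⟨t, ht⟩ := X_sq_sub_one_dvd_prod_sub_prod Finset.univ u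
    have hpN : p * (C (u i) * X - 1) = (-X) ^ r * N + (X ^ 2 - 1) * t := by
      rw [← ht, hp, Finset.prod_erase_mul _ _ (Finset.mem_univ i), Finset.card_univ,
        Fintype.card_fin, hN]
      ring
    have h1 : p * C (u i ^ 2 - 1) = p * (C (u i) * X - 1) * (C (u i) * X + 1) -
        (X ^ 2 - 1) * (p * C (u i) ^ 2) := by
      simp only [map_sub, map_pow, map_one]; ring
    -- This dictates the parity-dependent factor: `w` is chosen so that (-X)^r w ≡ -X modulo X² - 1.
    have h2 : (X ^ 2 - 1 : K[X]) ∣ (-X) ^ r * w + X := by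
      rcases Nat.even_or_odd r with h | h
      · have hw' : w = -X := by rw [hw, if_neg (Nat.not_odd_iff_even.mpr h)]
        obtain ⟨m, rfl⟩ := h
        rw [hw', Even.neg_pow ⟨m, rfl⟩, ← two_mul, pow_mul]
        have := sub_dvd_pow_sub_pow (X ^ 2 : K[X]) 1 m
        rw [one_pow] at this
        rw [show (X ^ 2) ^ m * -X + X = ((X ^ 2) ^ m - 1) * (-X : K[X]) by ring]
        exact this.mul_right _
      · have hw' : w = 1 := by rw [hw, if_pos h]
        rw [hw', Odd.neg_pow h]
        obtain ⟨m, rfl⟩ := h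
        rw [pow_succ X (2 * m), pow_mul]
        have := sub_dvd_pow_sub_pow (X ^ 2 : K[X]) 1 m
        rw [one_pow] at this
        rw [show -((X ^ 2) ^ m * X) * 1 + X = ((X ^ 2) ^ m - 1) * (-X : K[X]) by ring]
        exact this.mul_right _
    obtain ⟨s, hs⟩ := h2
    refine ⟨N * s * (C (u i) * X + 1) + t * w * (C (u i) * X + 1) - p * C (u i) ^ 2 * w -
      N * C (u i), ?_⟩
    have hs' : (-X) ^ r * w = (X ^ 2 - 1) * s - X := by rw [← hs]; ring
    calc H = (X + C (u i)) * N + (p * C (u i ^ 2 - 1)) * w := by rw [hH]; ring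
      _ = (X + C (u i)) * N + (N * ((-X) ^ r * w) + (X ^ 2 - 1) * t * w) * (C (u i) * X + 1) -
        (X ^ 2 - 1) * (p * C (u i) ^ 2) * w := by rw [h1, hpN]; ring
      _ = _ := by rw [hs']; ring
  obtain ⟨h, hh⟩ := hdvd
  have hXm : (X ^ 2 - 1 : K[X]).Monic := by
    simpa using monic_X_pow_sub_C (1 : K) two_ne_zero
  have hXd : (X ^ 2 - 1 : K[X]).natDegree = 2 := by
    simpa using natDegree_X_pow_sub_C (n := 2) (r := (1 : K))
  have hm : h.Monic := hXm.of_mul_monic_left (hh ▸ hHm)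
  have hd : h.natDegree = r - 1 := by
    have := hXm.natDegree_mul hm
    rw [← hh, hHd, hXd] at this
    omega
  have hdeg : h.degree < (Finset.univ : Finset (Fin r)).card := by
    rw [degree_eq_natDegree hm.ne_zero, hd, Finset.card_univ, Fintype.card_fin]
    exact_mod_cast (by omega : r - 1 < r)
  have hc := Lagrange.coeff_eq_sum (s := Finset.univ) (v := u) hu.injOn hdeg
  rw [Finset.card_univ, Fintype.card_fin, ← hd, hm.coeff_natDegree] at hc
  rw [eq_div_iff (hne i), Finset.sum_mul]
  refine Eq.trans ?_ hc.symm
  refine Finset.sum_congr rfl fun j _ => ?_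
  have he := congrArg (eval (u j)) hh
  have hNj : N.eval (u j) = 0 := by
    rw [hN, eval_prod]
    exact Finset.prod_eq_zero (Finset.mem_univ j) (by simp)
  have hwj : w.eval (u j) = if Odd r then 1 else -u j := by
    rw [hw]; split_ifs <;> simp
  rw [hH] at he
  simp only [eval_add, eval_mul, hNj, hwj, mul_zero, zero_add, eval_C, eval_sub, eval_pow, eval_X,
    eval_one, hp, eval_prod] at he
  rw [show h.eval (u j) = (u j ^ 2 - 1) * h.eval (u j) / (u j ^ 2 - 1) by
    rw [mul_div_cancel_left₀ _ (hne j)], ← he]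
  rw [div_div, div_mul_eq_mul_div]

/-- The solution of the Cauchy system `∑ j, x j / (u i * u j - 1) = 1 / (u i ^ 2 - 1) + c`. -/
def cauchySolution {K : Type*} [Field K] {r : ℕ} (u : Fin r → K) (c : K) (j : Fin r) : K :=
  (∏ l ∈ Finset.univ.erase j, (u l * u j - 1) / (u j - u l)) *
    ((u j ^ 2 - 1) * c * (∏ l ∈ Finset.univ.erase j, u l) + if Odd r then 1 else -u j)

theorem sum_cauchySolution_div {K : Type*} [Field K] {r : ℕ} {u : Fin r → K}
    (hu : Function.Injective u) (huu : ∀ i j, u i * u j ≠ 1) (c : K) (i : Fin r) :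
    ∑ j, cauchySolution u c j / (u i * u j - 1) = 1 / (u i ^ 2 - 1) + c := by
  have hne (i j : Fin r) : u i * u j - 1 ≠ 0 := sub_ne_zero.mpr (huu i j)
  have hc := congrArg (c * ·) (Lagrange.sum_prod_mul_sub_one_mul_prod_div hu i)
  simp only [mul_one, Finset.mul_sum] at hc
  rw [← Lagrange.sum_prod_mul_sub_one_div hu huu i]
  refine Eq.trans ?_ (congrArg (_ + ·) hc)
  rw [← Finset.sum_add_distrib]
  refine Finset.sum_congr rfl fun j _ => ?_
  have hsq : u j ^ 2 - 1 ≠ 0 := by rw [sq]; exact hne j j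
  have hD : ∏ l ∈ Finset.univ.erase j, (u j - u l) ≠ 0 :=
    Finset.prod_ne_zero_iff.mpr fun l hl =>
      sub_ne_zero.mpr fun h => (Finset.ne_of_mem_erase hl) (hu h).symm
  -- Both sides are the full product over l; this trades the omitted index j for i, as the two
  -- interpolation identities require.
  have h1 : (∏ l ∈ Finset.univ.erase j, (u l * u j - 1)) * (u j ^ 2 - 1) =
      (∏ l ∈ Finset.univ.erase i, (u l * u j - 1)) * (u i * u j - 1) := by
    rw [sq, Finset.prod_erase_mul _ (fun l => u l * u j - 1) (Finset.mem_univ j),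
      Finset.prod_erase_mul _ (fun l => u l * u j - 1) (Finset.mem_univ i)]
  rw [cauchySolution, Finset.prod_div_distrib, Finset.prod_div_distrib]
  have := hne i j
  set a := ∏ l ∈ Finset.univ.erase j, (u l * u j - 1)
  set b := ∏ l ∈ Finset.univ.erase i, (u l * u j - 1)
  have ha : a = b * (u i * u j - 1) / (u j ^ 2 - 1) := by rw [eq_div_iff hsq, h1]
  rw [ha]
  generalize (if Odd r then (1 : K) else -u j) = w
  field_simp
  ring

open Polynomial in
-- Clearing denominators turns the system into the vanishing of a polynomial of degree below r at
-- the r nodes, so it is zero; its value at u_j⁻¹ isolates x_j.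
theorem eq_zero_of_cauchy_sum_eq_zero {K : Type*} [Field K] {r : ℕ} {u x : Fin r → K}
    (hu : Function.Injective u) (hu0 : ∀ i, u i ≠ 0) (huu : ∀ i j, u i * u j ≠ 1)
    (h : ∀ i, ∑ j, x j / (u i * u j - 1) = 0) : x = 0 := by
  classical
  have hne (i j : Fin r) : u i * u j - 1 ≠ 0 := sub_ne_zero.mpr (huu i j)
  set p : K[X] := ∑ j, C (x j) * ∏ l ∈ Finset.univ.erase j, (C (u l) * X - 1) with hp
  have hpe (t : K) : p.eval t = ∑ j, x j * ∏ l ∈ Finset.univ.erase j, (u l * t - 1) := by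
    simp [hp, eval_finsetSum, eval_prod]
  rcases Nat.eq_zero_or_pos r with rfl | hr
  · exact Subsingleton.elim _ _
  have hpd : p.degree < (Finset.univ : Finset (Fin r)).card := by
    refine lt_of_le_of_lt degree_le_natDegree ?_
    rw [Finset.card_univ, Fintype.card_fin]
    refine Nat.cast_lt.mpr (lt_of_le_of_lt (natDegree_sum_le_of_forall_le _ _ (n := r - 1)
      fun j _ => ?_) (by omega))
    exact (natDegree_C_mul_le _ _).trans
      ((natDegree_prod_C_mul_X_sub_one_le _ u).trans_eq (by simp))
  have hp0 : p = 0 := by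
    refine Polynomial.eq_zero_of_degree_lt_of_eval_index_eq_zero (s := Finset.univ) (v := u) hu.injOn hpd fun i _ => ?_
    rw [hpe]
    calc _ = (∏ l, (u l * u i - 1)) * ∑ j, x j / (u i * u j - 1) := by
          rw [Finset.mul_sum]
          refine Finset.sum_congr rfl fun j _ => ?_
          rw [← Finset.prod_erase_mul _ _ (Finset.mem_univ j), mul_assoc, mul_comm (u j),
            mul_div_cancel₀ _ (hne i j), mul_comm]
      _ = 0 := by rw [h, mul_zero]
  funext j
  have he := hpe (u j)⁻¹
  rw [hp0, eval_zero, Finset.sum_eq_single j] at he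
  · refine (mul_eq_zero.mp he.symm).resolve_right (Finset.prod_ne_zero_iff.mpr fun l hl => ?_)
    rw [sub_ne_zero, Ne, mul_inv_eq_one₀ (hu0 j)]
    exact fun h => (Finset.ne_of_mem_erase hl) (hu h)
  · intro l _ hl
    rw [Finset.prod_eq_zero (Finset.mem_erase.mpr ⟨hl.symm, Finset.mem_univ j⟩), mul_zero]
    rw [mul_inv_cancel₀ (hu0 j), sub_self]
  · simp

theorem eq_cauchySolution {K : Type*} [Field K] {r : ℕ} {u x : Fin r → K}
    (hu : Function.Injective u) (hu0 : ∀ i, u i ≠ 0) (huu : ∀ i j, u i * u j ≠ 1) {c : K}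
    (h : ∀ i, ∑ j, x j / (u i * u j - 1) = 1 / (u i ^ 2 - 1) + c) : x = cauchySolution u c := by
  refine sub_eq_zero.mp (eq_zero_of_cauchy_sum_eq_zero hu hu0 huu fun i => ?_)
  simp only [Pi.sub_apply, sub_div, Finset.sum_sub_distrib, h, sum_cauchySolution_div hu huu,
    sub_self]

/-! ### Relations in W_2 and the left ideal generated by e. -/

namespace GroundParams

section Relations

variable {S : Type*} [CommRing S] {r : ℕ} (P : GroundParams S r)

/-- The element `g` of `W_2`. -/
noncomputable def g₁ : P.W₂ := P.gen (BMWGen.g ⟨0, Nat.one_pos⟩)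

/-- The element `g⁻¹` of `W_2`. -/
noncomputable def gInv₁ : P.W₂ := P.gen (BMWGen.gInv ⟨0, Nat.one_pos⟩)

/-- The element `y_1⁻¹` of `W_2`. -/
noncomputable def yInv₁ : P.W₂ := P.gen BMWGen.yInv

/-- The parameter `q - q⁻¹`. -/
def z : S := (P.q : S) - ((P.q⁻¹ : Sˣ) : S)

open Polynomial in
/-- The polynomial `(X - u_1) ⋯ (X - u_r)`. -/
noncomputable def cycPoly : S[X] := ∏ i, (X - C (P.u i : S))

theorem gInv₁_mul_g₁ : P.gInv₁ * P.g₁ = 1 := by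
  simpa [gInv₁, g₁, gen] using RingQuot.mkAlgHom_rel S (BMWRel.gInv_mul_g (P := P) (n := 2) _)

theorem yInv₁_mul_y₁ : P.yInv₁ * P.y₁ = 1 := by
  simpa [yInv₁, y₁, gen] using RingQuot.mkAlgHom_rel S (BMWRel.yInv_mul_y (P := P) (n := 2))

theorem e₁_mul_e₁ : P.e₁ * P.e₁ = P.δ 0 • P.e₁ := by
  simpa [e₁, gen] using RingQuot.mkAlgHom_rel S (BMWRel.e_sq (P := P) (n := 2) _)

theorem y₁_g₁_braid : P.y₁ * P.g₁ * P.y₁ * P.g₁ = P.g₁ * P.y₁ * P.g₁ * P.y₁ := by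
  simpa [g₁, y₁, gen] using
    RingQuot.mkAlgHom_rel S (BMWRel.braid_y (P := P) (n := 2) ⟨0, Nat.one_pos⟩ rfl)

theorem e₁_mul_y₁_pow_mul_e₁ (k : ℕ) : P.e₁ * P.y₁ ^ k * P.e₁ = P.δ k • P.e₁ := by
  rcases Nat.eq_zero_or_pos k with rfl | hk
  · rw [pow_zero, mul_one, e₁_mul_e₁]
  · simpa [e₁, y₁, gen] using
      RingQuot.mkAlgHom_rel S (BMWRel.e_y_pow_e (P := P) (n := 2) ⟨0, Nat.one_pos⟩ rfl k hk)

theorem gInv₁_eq : P.gInv₁ = P.g₁ - P.z • (1 - P.e₁) := by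
  have h : P.g₁ - P.gInv₁ = P.z • (1 - P.e₁) := by
    simpa [e₁, g₁, gInv₁, z, gen] using
      RingQuot.mkAlgHom_rel S (BMWRel.skein (P := P) (n := 2) ⟨0, Nat.one_pos⟩)
  rw [← h, sub_sub_cancel]

theorem g₁_mul_e₁ : P.g₁ * P.e₁ = ((P.ρ⁻¹ : Sˣ) : S) • P.e₁ := by
  simpa [e₁, g₁, gen] using
    RingQuot.mkAlgHom_rel S (BMWRel.g_e (P := P) (n := 2) ⟨0, Nat.one_pos⟩)

theorem y₁_g₁_y₁_mul_e₁ : P.y₁ * P.g₁ * P.y₁ * P.e₁ = (P.ρ : S) • P.e₁ := by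
  simpa [e₁, g₁, y₁, gen] using
    RingQuot.mkAlgHom_rel S (BMWRel.unwrap_e (P := P) (n := 2) ⟨0, Nat.one_pos⟩ rfl)

open Polynomial in
theorem aeval_y₁_cycPoly : aeval P.y₁ P.cycPoly = 0 := by
  have h := RingQuot.mkAlgHom_rel S (BMWRel.cyclotomic (P := P) (n := 2))
  rw [map_list_prod, map_zero, List.map_ofFn] at h
  rw [cycPoly, ← List.prod_ofFn, map_list_prod, List.map_ofFn, ← h]
  congr 2
  funext k
  simp [y₁, gen]

/-- By the braid relation y commutes with gyg, and unwrapping with untwisting gives ygyg e = e.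
Hence g times the left side is y^k e, and the skein relation expands g⁻¹ y^k e. -/
theorem y₁_mul_g₁_mul_y₁_pow_succ_mul_e₁ (k : ℕ) :
    P.y₁ * P.g₁ * P.y₁ ^ (k + 1) * P.e₁ =
      P.g₁ * P.y₁ ^ k * P.e₁ - P.z • (P.y₁ ^ k * P.e₁) + (P.z * P.δ k) • P.e₁ := by
  have hc : Commute P.y₁ (P.g₁ * P.y₁ * P.g₁) := by
    have := P.y₁_g₁_braid
    simp only [Commute, SemiconjBy, mul_assoc] at this ⊢
    exact this
  have h1 : P.y₁ * (P.g₁ * P.y₁ * P.g₁) * P.e₁ = P.e₁ := by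
    calc P.y₁ * (P.g₁ * P.y₁ * P.g₁) * P.e₁ = P.y₁ * P.g₁ * P.y₁ * (P.g₁ * P.e₁) := by
          simp only [mul_assoc]
      _ = P.e₁ := by
          rw [g₁_mul_e₁, mul_smul_comm, y₁_g₁_y₁_mul_e₁, smul_smul, Units.inv_mul, one_smul]
  have h2 : P.g₁ * (P.y₁ * P.g₁ * P.y₁ ^ (k + 1) * P.e₁) = P.y₁ ^ k * P.e₁ := by
    calc _ = (P.g₁ * P.y₁ * P.g₁) * P.y₁ ^ (k + 1) * P.e₁ := by simp only [mul_assoc]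
      _ = P.y₁ ^ k * (P.y₁ * (P.g₁ * P.y₁ * P.g₁) * P.e₁) := by
          rw [← (hc.pow_left (k + 1)).eq, pow_succ]; simp only [mul_assoc]
      _ = _ := by rw [h1]
  have h3 := congrArg (P.gInv₁ * ·) h2
  simp only [← mul_assoc P.gInv₁ P.g₁, gInv₁_mul_g₁, one_mul] at h3
  rw [h3, gInv₁_eq, sub_mul, smul_mul_assoc, sub_mul, one_mul, ← mul_assoc, ← mul_assoc,
    e₁_mul_y₁_pow_mul_e₁, smul_sub, smul_smul]
  abel

end Relations

section Modules

open Polynomial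

variable {S : Type*} [CommRing S] {r : ℕ} (P : GroundParams S r)

/-- Write f = hX + a with a a unit; multiplying h(y) y + a = 0 on the right by y' yields y' = -a⁻¹
h(y). -/
theorem exists_aeval_eq_of_mul_eq_one {A : Type*} [Ring A] [Algebra S A] {y y' : A} {f : S[X]}
    (hf : IsUnit (f.coeff 0)) (h : aeval y f = 0) (hy : y * y' = 1) :
    ∃ p : S[X], aeval y p = y' := by
  obtain ⟨a, ha⟩ := hf
  rw [← divX_mul_X_add f, ← ha] at h
  simp only [map_add, map_mul, aeval_X, aeval_C] at h
  have h2 := congrArg (· * y') h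
  simp only [add_mul, mul_assoc, hy, mul_one, zero_mul] at h2
  refine ⟨-(C ((a⁻¹ : Sˣ) : S) * divX f), ?_⟩
  rw [map_neg, map_mul, aeval_C, eq_neg_of_add_eq_zero_left h2, mul_neg, neg_neg, ← mul_assoc,
    ← map_mul, Units.inv_mul, map_one, one_mul]

theorem cycPoly_monic : P.cycPoly.Monic :=
  monic_prod_of_monic _ _ fun _ _ => monic_X_sub_C _

theorem natDegree_cycPoly [Nontrivial S] : P.cycPoly.natDegree = r := by
  rw [cycPoly, natDegree_prod_of_monic _ _ fun _ _ => monic_X_sub_C _]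
  simp

theorem exists_aeval_y₁_eq_yInv₁ : ∃ p : S[X], aeval P.y₁ p = P.yInv₁ := by
  refine exists_aeval_eq_of_mul_eq_one (f := P.cycPoly) ?_ P.aeval_y₁_cycPoly ?_
  · rw [coeff_zero_eq_eval_zero, cycPoly, eval_prod]
    refine IsUnit.prod_univ_iff.mpr fun i => ?_
    simp
  · simpa [yInv₁, y₁, gen] using RingQuot.mkAlgHom_rel S (BMWRel.y_mul_yInv (P := P) (n := 2))

/-- The `S`-span of `e, y_1 e, …, y_1 ^ (r - 1) e`. -/
noncomputable def cyclicSpan : Submodule S P.W₂ :=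
  Submodule.span S (Set.range fun k : Fin r => P.y₁ ^ k.val * P.e₁)

theorem mul_mem_cyclicSpan_of_forall {w : P.W₂} (h : ∀ k : ℕ, w * (P.y₁ ^ k * P.e₁) ∈ P.cyclicSpan)
    {m : P.W₂} (hm : m ∈ P.cyclicSpan) : w * m ∈ P.cyclicSpan := by
  have : P.cyclicSpan ≤ P.cyclicSpan.comap (LinearMap.mulLeft S w) := by
    conv_lhs => rw [cyclicSpan]
    rw [Submodule.span_le]
    rintro _ ⟨k, rfl⟩
    exact h k
  exact this hm

variable [Nontrivial S]

theorem aeval_mul_e₁_mem_cyclicSpan (p : S[X]) : aeval P.y₁ p * P.e₁ ∈ P.cyclicSpan := by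
  rw [← aeval_modByMonic_eq_self_of_root P.aeval_y₁_cycPoly (p := p)]
  -- For r = 0 the remainder is 0 but its `natDegree` is not below r, so this case is separate.
  rcases Nat.eq_zero_or_pos r with h | h
  · have : P.cycPoly = 1 := by
      subst h
      simp [cycPoly]
    rw [this, modByMonic_one, map_zero, zero_mul]
    exact zero_mem _
  have hd : (p %ₘ P.cycPoly).natDegree < r := by
    conv_rhs => rw [← P.natDegree_cycPoly]
    refine natDegree_modByMonic_lt _ P.cycPoly_monic fun h1 => ?_
    have := P.natDegree_cycPoly
    rw [h1, natDegree_one] at this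
    omega
  rw [aeval_eq_sum_range' hd, Finset.sum_mul]
  refine Submodule.sum_mem _ fun k hk => ?_
  rw [smul_mul_assoc]
  exact Submodule.smul_mem _ _ (Submodule.subset_span ⟨⟨k, Finset.mem_range.mp hk⟩, rfl⟩)

theorem y₁_pow_mul_e₁_mem_cyclicSpan (k : ℕ) : P.y₁ ^ k * P.e₁ ∈ P.cyclicSpan := by
  simpa using P.aeval_mul_e₁_mem_cyclicSpan (X ^ k)

theorem e₁_mem_cyclicSpan : P.e₁ ∈ P.cyclicSpan := by
  simpa using P.y₁_pow_mul_e₁_mem_cyclicSpan 0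

theorem yInv₁_mul_mem_cyclicSpan {m : P.W₂} (hm : m ∈ P.cyclicSpan) :
    P.yInv₁ * m ∈ P.cyclicSpan := by
  refine P.mul_mem_cyclicSpan_of_forall (fun k => ?_) hm
  obtain ⟨p, hp⟩ := P.exists_aeval_y₁_eq_yInv₁
  have h := P.aeval_mul_e₁_mem_cyclicSpan (p * X ^ k)
  rwa [map_mul, hp, map_pow, aeval_X, mul_assoc] at h

theorem e₁_mul_mem_cyclicSpan {m : P.W₂} (hm : m ∈ P.cyclicSpan) :
    P.e₁ * m ∈ P.cyclicSpan := by
  refine P.mul_mem_cyclicSpan_of_forall (fun k => ?_) hm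
  rw [← mul_assoc, e₁_mul_y₁_pow_mul_e₁]
  exact Submodule.smul_mem _ _ P.e₁_mem_cyclicSpan

theorem g₁_mul_mem_cyclicSpan {m : P.W₂} (hm : m ∈ P.cyclicSpan) :
    P.g₁ * m ∈ P.cyclicSpan := by
  refine P.mul_mem_cyclicSpan_of_forall (fun k => ?_) hm
  induction k with
  | zero =>
    rw [pow_zero, one_mul, g₁_mul_e₁]
    exact Submodule.smul_mem _ _ P.e₁_mem_cyclicSpan
  | succ k ih =>
    have h := P.y₁_mul_g₁_mul_y₁_pow_succ_mul_e₁ k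
    -- The recursion only controls y g y^(k+1) e, so y is cancelled on the left by y⁻¹, which
    -- preserves the span.
    have h2 : P.g₁ * (P.y₁ ^ (k + 1) * P.e₁) =
        P.yInv₁ * (P.y₁ * P.g₁ * P.y₁ ^ (k + 1) * P.e₁) := by
      simp only [← mul_assoc, yInv₁_mul_y₁, one_mul]
    rw [h2, h]
    refine P.yInv₁_mul_mem_cyclicSpan (Submodule.add_mem _ (Submodule.sub_mem _ ?_ ?_) ?_)
    · rwa [mul_assoc]
    · exact Submodule.smul_mem _ _ (P.y₁_pow_mul_e₁_mem_cyclicSpan k)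
    · exact Submodule.smul_mem _ _ P.e₁_mem_cyclicSpan

theorem mul_mem_cyclicSpan (w : P.W₂) {m : P.W₂} (hm : m ∈ P.cyclicSpan) :
    w * m ∈ P.cyclicSpan := by
  obtain ⟨x, rfl⟩ := RingQuot.mkAlgHom_surjective S (P.BMWRel 2) w
  induction x using FreeAlgebra.induction generalizing m with
  | grade0 s =>
    rw [AlgHom.commutes, ← Algebra.smul_def]
    exact Submodule.smul_mem _ _ hm
  | grade1 x =>
    cases x with
    | y =>
      refine P.mul_mem_cyclicSpan_of_forall (fun k => ?_) hm
      have := P.y₁_pow_mul_e₁_mem_cyclicSpan (k + 1)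
      rwa [pow_succ', mul_assoc] at this
    | yInv => exact P.yInv₁_mul_mem_cyclicSpan hm
    | g i =>
      rw [show i = ⟨0, Nat.one_pos⟩ from Subsingleton.elim (α := Fin 1) _ _]
      exact P.g₁_mul_mem_cyclicSpan hm
    | gInv i =>
      rw [show i = ⟨0, Nat.one_pos⟩ from Subsingleton.elim (α := Fin 1) _ _]
      change P.gInv₁ * m ∈ _
      rw [gInv₁_eq, sub_mul, smul_mul_assoc, sub_mul, one_mul]
      exact Submodule.sub_mem _ (P.g₁_mul_mem_cyclicSpan hm)
        (Submodule.smul_mem _ _ (Submodule.sub_mem _ hm (P.e₁_mul_mem_cyclicSpan hm)))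
    | e i =>
      rw [show i = ⟨0, Nat.one_pos⟩ from Subsingleton.elim (α := Fin 1) _ _]
      exact P.e₁_mul_mem_cyclicSpan hm
  | mul a b ha hb =>
    rw [map_mul, mul_assoc]
    exact ha (hb hm)
  | add a b ha hb =>
    rw [map_add, add_mul]
    exact Submodule.add_mem _ (ha hm) (hb hm)

end Modules

/-- The module is W_2 e with v_0 = e: `mul_mem_cyclicSpan` gives spanning, and e² = δ_0 e gives the
eigenvalue. -/
theorem hasCyclicModule_of_linearIndependent {S : Type*} [CommRing S] [Nontrivial S] {r : ℕ}
    (P : GroundParams S r)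
    (h : LinearIndependent S (fun k : Fin r => P.y₁ ^ k.val * P.e₁)) : P.HasCyclicModule := by
  let M : Submodule P.W₂ P.W₂ := Submodule.span P.W₂ {P.e₁}
  have hmem (w : P.W₂) : w * P.e₁ ∈ M := Submodule.mem_span_singleton.mpr ⟨w, rfl⟩
  let v : Fin r → M := fun k => ⟨P.y₁ ^ k.val * P.e₁, hmem _⟩
  have hv : LinearIndependent S v :=
    LinearIndependent.of_comp (M.subtype.restrictScalars S) h
  have hs : ⊤ ≤ Submodule.span S (Set.range v) := by
    rintro ⟨x, hx⟩ -
    obtain ⟨w, rfl⟩ := Submodule.mem_span_singleton.mp hx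
    have h1 : w * P.e₁ ∈ (Submodule.span S (Set.range v)).map (M.subtype.restrictScalars S) := by
      rw [Submodule.map_span, ← Set.range_comp]
      exact P.mul_mem_cyclicSpan w P.e₁_mem_cyclicSpan
    obtain ⟨m, hm, hmx⟩ := h1
    rwa [show (⟨w • P.e₁, hx⟩ : M) = m from Subtype.ext hmx.symm]
  refine ⟨M, inferInstance, inferInstance, inferInstance, inferInstance,
    ⟨P.e₁, Submodule.mem_span_singleton_self _⟩, Module.Basis.mk hv hs, fun k => ?_, ?_⟩
  · rw [Module.Basis.mk_apply]
    rfl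
  · exact Subtype.ext P.e₁_mul_e₁

end GroundParams

/-! ### Functionals on S[X] that vanish on multiples of ∏(X - u_i). -/

namespace GroundParams

open Polynomial

section Functionals

variable {S : Type*} [CommRing S] {r : ℕ} (P : GroundParams S r)

theorem coeff_cycPoly {k : ℕ} (hk : k ≤ r) : P.cycPoly.coeff k =
    (-1) ^ (r - k) * (Finset.univ.val.map fun i : Fin r => (P.u i : S)).esymm (r - k) := by
  have h := Multiset.prod_X_sub_C_coeff (Finset.univ.val.map fun i : Fin r => (P.u i : S)) (k := k)
    (by simpa using hk)
  rw [Multiset.map_map] at h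
  simpa [cycPoly, Finset.prod] using h

theorem eval_cycPoly (i : Fin r) : P.cycPoly.eval (P.u i : S) = 0 := by
  rw [cycPoly, eval_prod]
  exact Finset.prod_eq_zero (Finset.mem_univ i) (by simp)

/-- The functional on `S[X]` that maps `X ^ k` to `δ_k`. -/
noncomputable def deltaFunctional : S[X] →ₗ[S] S := (basisMonomials S).constr S P.δ

theorem deltaFunctional_X_pow (k : ℕ) : P.deltaFunctional (X ^ k) = P.δ k := by
  have h := (basisMonomials S).constr_basis S P.δ k
  simpa [deltaFunctional, ← monomial_one_right_eq_X_pow] using h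

theorem eq_of_forall_X_pow {A B : S[X] →ₗ[S] S} (h : ∀ k : ℕ, A (X ^ k) = B (X ^ k)) : A = B := by
  refine (basisMonomials S).ext fun k => ?_
  simpa [← monomial_one_right_eq_X_pow] using h k

/-- For a ≥ 0 the sum in weak admissibility is the value of the functional at `P.cycPoly * X ^ a`.
-/
theorem WeaklyAdmissible.deltaFunctional_cycPoly_mul [Nontrivial S] {P : GroundParams S r}
    (h : P.WeaklyAdmissible) (p : S[X]) : P.deltaFunctional (P.cycPoly * p) = 0 := by
  have h0 : P.deltaFunctional ∘ₗ LinearMap.mulLeft S P.cycPoly = 0 := by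
    refine eq_of_forall_X_pow fun a => ?_
    rw [LinearMap.comp_apply, LinearMap.mulLeft_apply, P.cycPoly.as_sum_range' (r + 1)
      (by rw [P.natDegree_cycPoly]; exact r.lt_succ_self), Finset.sum_mul, map_sum,
      LinearMap.zero_apply, ← h a]
    refine Finset.sum_congr rfl fun k hk => ?_
    rw [← smul_X_eq_monomial, smul_mul_assoc, ← pow_add, map_smul, deltaFunctional_X_pow,
      P.coeff_cycPoly (Nat.lt_succ_iff.mp (Finset.mem_range.mp hk)), smul_eq_mul,
      ← deltaInt_natCast]
    push_cast
    rfl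
  exact LinearMap.congr_fun h0 p

/-- The polynomial `∏_{l ≠ j} (X - u_l)`. -/
noncomputable def nodePoly (j : Fin r) : S[X] := ∏ l ∈ Finset.univ.erase j, (X - C (P.u l : S))

theorem nodePoly_mul (j : Fin r) : P.nodePoly j * (X - C (P.u j : S)) = P.cycPoly :=
  Finset.prod_erase_mul _ _ (Finset.mem_univ j)

theorem eval_nodePoly_of_ne {i j : Fin r} (h : i ≠ j) : (P.nodePoly j).eval (P.u i : S) = 0 := by
  rw [nodePoly, eval_prod]
  exact Finset.prod_eq_zero (Finset.mem_erase.mpr ⟨h, Finset.mem_univ i⟩) (by simp)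

variable {P}

theorem eval_nodePoly_self_ne_zero [IsDomain S] (hu : Function.Injective P.u) (j : Fin r) :
    (P.nodePoly j).eval (P.u j : S) ≠ 0 := by
  rw [nodePoly, eval_prod]
  refine Finset.prod_ne_zero_iff.mpr fun l hl => ?_
  rw [eval_sub, eval_X, eval_C, sub_ne_zero]
  exact fun h => (Finset.ne_of_mem_erase hl) (hu (Units.ext h)).symm

theorem cycPoly_dvd_of_eval_eq_zero [IsDomain S] (hu : Function.Injective P.u) {p : S[X]}
    (h : ∀ i, p.eval (P.u i : S) = 0) : P.cycPoly ∣ p := by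
  rcases eq_or_ne p 0 with rfl | hp
  · exact dvd_zero _
  have h1 := (Multiset.prod_X_sub_C_dvd_iff_le_roots hp
    (Finset.univ.val.map fun i : Fin r => (P.u i : S))).mpr <| by
      refine (Multiset.le_iff_subset ?_).mpr ?_
      · exact Multiset.Nodup.map (fun i j hij => hu (Units.ext hij)) Finset.univ.nodup
      · intro x hx
        obtain ⟨i, -, rfl⟩ := Multiset.mem_map.mp hx
        exact (mem_roots hp).mpr (h i)
  rwa [Multiset.map_map] at h1

/-- Such a functional depends only on the values of p at the nodes, so it can be applied to the
Lagrange interpolant of p. -/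
theorem functional_eq_sum [IsDomain S] {K : Type*} [Field K] [Algebra S K] [FaithfulSMul S K]
    (hu : Function.Injective P.u)
    {A : S[X] →ₗ[S] S} (hA : ∀ p, A (P.cycPoly * p) = 0) (p : S[X]) :
    algebraMap S K (A p) = ∑ j, algebraMap S K (A (P.nodePoly j)) /
      algebraMap S K ((P.nodePoly j).eval (P.u j : S)) * algebraMap S K (p.eval (P.u j : S)) := by
  classical
  set w : Fin r → S := fun j => (P.nodePoly j).eval (P.u j : S) with hw
  have hw0 (j : Fin r) : algebraMap S K (w j) ≠ 0 :=
    (map_ne_zero_iff _ (FaithfulSMul.algebraMap_injective S K)).mpr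
      (eval_nodePoly_self_ne_zero hu j)
  -- Lagrange interpolation multiplied by all denominators, so that the congruence lives in S[X],
  -- where `A` is defined.
  have hdvd : P.cycPoly ∣ (∏ j, w j) • p -
      ∑ j, ((∏ l ∈ Finset.univ.erase j, w l) * p.eval (P.u j : S)) • P.nodePoly j := by
    refine cycPoly_dvd_of_eval_eq_zero hu fun i => ?_
    rw [eval_sub, eval_finsetSum, Finset.sum_eq_single i]
    · rw [eval_smul, eval_smul, smul_eq_mul, smul_eq_mul,
        ← Finset.prod_erase_mul _ _ (Finset.mem_univ i)]
      ring
    · intro j _ hj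
      rw [eval_smul, P.eval_nodePoly_of_ne hj.symm, smul_zero]
    · simp
  obtain ⟨t, ht⟩ := hdvd
  have h := congrArg A ht
  rw [hA, map_sub, map_smul, map_sum, sub_eq_zero] at h
  have hD : algebraMap S K (∏ j, w j) ≠ 0 := by
    rw [map_prod]
    exact Finset.prod_ne_zero_iff.mpr fun j _ => hw0 j
  refine mul_left_cancel₀ hD ?_
  rw [← map_mul, ← smul_eq_mul, h, map_sum, Finset.mul_sum]
  refine Finset.sum_congr rfl fun j _ => ?_
  rw [← Finset.prod_erase_mul _ _ (Finset.mem_univ j), map_smul, smul_eq_mul, map_mul, map_mul,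
    map_mul]
  have := hw0 j
  rw [hw] at this ⊢
  field_simp

end Functionals

/-! ### Eigenfunctionals on a cyclic module. -/

section CyclicModule

variable {S : Type*} [CommRing S] {r : ℕ} {P : GroundParams S r}
  {M : Type*} [AddCommGroup M] [Module S M] [Module P.W₂ M] [IsScalarTower S P.W₂ M] {v₀ : M}

/-- Since δ_0 is invertible, v_0 = δ_0⁻¹ e v_0; thus identities in W_2 e transfer to M. -/
theorem smul_eq_smul_of_mul_e₁_eq (hv : P.e₁ • v₀ = P.δ 0 • v₀) {a b : P.W₂}
    (h : a * P.e₁ = b * P.e₁) : a • v₀ = b • v₀ := by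
  obtain ⟨d, hd⟩ := P.isUnit_δ_zero
  have h1 (w : P.W₂) : w • v₀ = ((d⁻¹ : Sˣ) : S) • (w * P.e₁) • v₀ := by
    rw [mul_smul, hv, smul_comm w, smul_smul, ← hd, Units.inv_mul, one_smul]
  rw [h1 a, h1 b, h]

variable {b : Module.Basis (Fin r) S M}

/-- The functional on a cyclic module that is an eigenvector of the transpose of `y_1` with
eigenvalue `u_i` and maps the cyclic generator to `1`. -/
noncomputable def eigenFunctional (P : GroundParams S r) (b : Module.Basis (Fin r) S M)
    (i : Fin r) : M →ₗ[S] S :=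
  b.constr S fun k => (P.u i : S) ^ k.val

/-- Reducing p modulo the cyclotomic polynomial changes neither side, and the remainder is a
combination of X^k with k < r, where the functional is defined by its values on the basis. -/
theorem eigenFunctional_aeval [Nontrivial S] (hb : ∀ k : Fin r, b k = P.y₁ ^ k.val • v₀)
    (i : Fin r) (p : S[X]) :
    eigenFunctional P b i (aeval P.y₁ p • v₀) = p.eval (P.u i : S) := by
  have h0 : aeval (P.u i : S) P.cycPoly = 0 := by
    rw [coe_aeval_eq_eval, P.eval_cycPoly]
  have h1 := aeval_modByMonic_eq_self_of_root h0 (p := p)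
  rw [coe_aeval_eq_eval] at h1
  rw [← h1, ← aeval_modByMonic_eq_self_of_root P.aeval_y₁_cycPoly (p := p)]
  have hd : (p %ₘ P.cycPoly).natDegree < r := by
    conv_rhs => rw [← P.natDegree_cycPoly]
    refine natDegree_modByMonic_lt _ P.cycPoly_monic fun h1 => ?_
    have := P.natDegree_cycPoly
    rw [h1, natDegree_one] at this
    have := i.pos
    omega
  rw [aeval_eq_sum_range' hd, eval_eq_sum_range' hd, Finset.sum_smul, map_sum]
  refine Finset.sum_congr rfl fun k hk => ?_
  have := b.constr_basis S (fun k => (P.u i : S) ^ k.val) ⟨k, Finset.mem_range.mp hk⟩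
  rw [hb] at this
  rw [smul_assoc, map_smul, smul_eq_mul, ← this]
  rfl

theorem eigenFunctional_y₁_smul [Nontrivial S] (hb : ∀ k : Fin r, b k = P.y₁ ^ k.val • v₀)
    (i : Fin r) (m : M) :
    eigenFunctional P b i (P.y₁ • m) = P.u i * eigenFunctional P b i m := by
  have h : eigenFunctional P b i ∘ₗ Algebra.lsmul S S M P.y₁ =
      (P.u i : S) • eigenFunctional P b i := by
    refine b.ext fun k => ?_
    have h1 := eigenFunctional_aeval hb i (X ^ k.val)
    have h2 := eigenFunctional_aeval hb i (X ^ (k.val + 1))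
    rw [map_pow, aeval_X] at h1 h2
    rw [LinearMap.comp_apply, hb, LinearMap.smul_apply, h1]
    change eigenFunctional P b i (P.y₁ • P.y₁ ^ k.val • v₀) = _
    rw [← mul_smul, ← pow_succ', h2, smul_eq_mul]
    simp [pow_succ']
  exact LinearMap.congr_fun h m

/-- The functional `p ↦ χ_i (g p(y_1) v_0)`, where `χ_i` is the eigenfunctional. -/
noncomputable def braidFunctional (P : GroundParams S r) [Module P.W₂ M] [IsScalarTower S P.W₂ M]
    (b : Module.Basis (Fin r) S M) (v₀ : M) (i : Fin r) : S[X] →ₗ[S] S :=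
  eigenFunctional P b i ∘ₗ (LinearMap.toSpanSingleton P.W₂ M v₀).restrictScalars S ∘ₗ
    LinearMap.mulLeft S P.g₁ ∘ₗ (aeval P.y₁).toLinearMap

theorem braidFunctional_apply (i : Fin r) (p : S[X]) :
    braidFunctional P b v₀ i p = eigenFunctional P b i ((P.g₁ * aeval P.y₁ p) • v₀) := rfl

theorem braidFunctional_cycPoly_mul (i : Fin r) (p : S[X]) :
    braidFunctional P b v₀ i (P.cycPoly * p) = 0 := by
  rw [braidFunctional_apply, map_mul, aeval_y₁_cycPoly, zero_mul, mul_zero, zero_smul, map_zero]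

theorem braidFunctional_one [Nontrivial S] (hb : ∀ k : Fin r, b k = P.y₁ ^ k.val • v₀)
    (hv : P.e₁ • v₀ = P.δ 0 • v₀) (i : Fin r) :
    braidFunctional P b v₀ i 1 = ((P.ρ⁻¹ : Sˣ) : S) := by
  have h : P.g₁ • v₀ = (((P.ρ⁻¹ : Sˣ) : S) • (1 : P.W₂)) • v₀ := by
    refine smul_eq_smul_of_mul_e₁_eq hv ?_
    rw [g₁_mul_e₁, smul_mul_assoc, one_mul]
  have h1 := eigenFunctional_aeval hb i 1
  rw [map_one, one_smul, eval_one] at h1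
  rw [braidFunctional_apply, map_one, mul_one, h, smul_assoc, one_smul, map_smul, h1, smul_eq_mul,
    mul_one]

/-- The eigenfunctional applied to the relation for y g y^(k+1) e: the leftmost y becomes u_i, and
δ_k becomes the functional `deltaFunctional`. -/
theorem mul_braidFunctional_X_mul [Nontrivial S] (hb : ∀ k : Fin r, b k = P.y₁ ^ k.val • v₀)
    (hv : P.e₁ • v₀ = P.δ 0 • v₀) (i : Fin r) (p : S[X]) :
    (P.u i : S) * braidFunctional P b v₀ i (X * p) =
      braidFunctional P b v₀ i p - P.z * p.eval (P.u i : S) + P.z * P.deltaFunctional p := by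
  have h : (P.u i : S) • (braidFunctional P b v₀ i ∘ₗ LinearMap.mulLeft S X) =
      braidFunctional P b v₀ i - P.z • leval (P.u i : S) + P.z • P.deltaFunctional := by
    refine eq_of_forall_X_pow fun k => ?_
    have h1 : (P.y₁ * P.g₁ * P.y₁ ^ (k + 1)) • v₀ =
        (P.g₁ * P.y₁ ^ k - P.z • P.y₁ ^ k + (P.z * P.δ k) • 1) • v₀ := by
      refine smul_eq_smul_of_mul_e₁_eq hv ?_
      rw [y₁_mul_g₁_mul_y₁_pow_succ_mul_e₁, add_mul, sub_mul, smul_mul_assoc, smul_mul_assoc,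
        one_mul]
    have h2 := congrArg (eigenFunctional P b i) h1
    have h3 := eigenFunctional_aeval hb i 1
    have h4 := eigenFunctional_aeval hb i (X ^ k)
    rw [map_one, one_smul, eval_one] at h3
    rw [map_pow, aeval_X] at h4
    rw [mul_assoc, mul_smul, eigenFunctional_y₁_smul hb, add_smul, sub_smul, smul_assoc,
      smul_assoc, one_smul, map_add, map_sub, (eigenFunctional P b i).map_smul P.z,
      (eigenFunctional P b i).map_smul (P.z * P.δ k), h3, h4] at h2
    simp only [LinearMap.smul_apply, LinearMap.comp_apply, LinearMap.mulLeft_apply,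
      LinearMap.add_apply, LinearMap.sub_apply, braidFunctional_apply, ← pow_succ', map_pow,
      aeval_X, smul_eq_mul, leval_apply, deltaFunctional_X_pow]
    simpa using h2
  exact LinearMap.congr_fun h p

end CyclicModule

/-! ### Identification of the coefficients γ_j. -/

section Gamma

variable {S : Type*} [CommRing S] {K : Type*} [Field K] [Algebra S K] {r : ℕ}
  (P : GroundParams S r)

theorem algebraMap_unit_inv (x : Sˣ) :
    algebraMap S K ((x⁻¹ : Sˣ) : S) = (algebraMap S K x)⁻¹ := by
  refine eq_inv_of_mul_eq_one_left ?_
  rw [← map_mul, Units.inv_mul, map_one]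

theorem gamma_eq_cauchySolution (j : Fin r) :
    P.gamma K j = cauchySolution (fun l => algebraMap S K (P.u l))
      (algebraMap S K ((P.ρ⁻¹ : Sˣ) : S) / algebraMap S K P.z) j := by
  have h : (1 - algebraMap S K (P.u j) ^ 2) /
      (algebraMap S K P.ρ * ((algebraMap S K P.q)⁻¹ - algebraMap S K P.q)) =
      (algebraMap S K (P.u j) ^ 2 - 1) * (algebraMap S K ((P.ρ⁻¹ : Sˣ) : S) /
        algebraMap S K P.z) := by
    rw [z, map_sub, algebraMap_unit_inv, algebraMap_unit_inv, ← neg_sub (algebraMap S K P.q),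
      mul_neg, div_neg, ← neg_div, neg_sub, div_eq_mul_inv, mul_inv, div_eq_mul_inv]
  rw [gamma, cauchySolution, h]

variable {P} [IsDomain S] [FaithfulSMul S K]

theorem delta_eq_of_hasCyclicModule (hq : P.z ≠ 0) (hu : Function.Injective P.u)
    (huu : ∀ i j : Fin r, (P.u i : S) * (P.u j : S) ≠ 1) (hw : P.WeaklyAdmissible)
    (hM : P.HasCyclicModule) (a : ℕ) :
    algebraMap S K (P.δ a) = ∑ j : Fin r, P.gamma K j * algebraMap S K (P.u j) ^ a := by
  obtain ⟨M, _, _, _, _, v₀, b, hb, hv⟩ := hM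
  have hinj := FaithfulSMul.algebraMap_injective S K
  -- The Lagrange coordinates of the functional X^k ↦ δ_k; they are to be shown equal to γ.
  set x : Fin r → K := fun j => algebraMap S K (P.deltaFunctional (P.nodePoly j)) /
      algebraMap S K ((P.nodePoly j).eval (P.u j : S)) with hx
  set c : K := algebraMap S K ((P.ρ⁻¹ : Sˣ) : S) / algebraMap S K P.z with hc
  have hz : algebraMap S K P.z ≠ 0 := (map_ne_zero_iff _ hinj).mpr hq
  have huK (i j : Fin r) : algebraMap S K (P.u i) * algebraMap S K (P.u j) ≠ 1 := by
    rw [← map_mul, Ne, ← map_one (algebraMap S K), hinj.eq_iff]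
    exact huu i j
  have hxs : x = cauchySolution (fun l => algebraMap S K (P.u l)) c := by
    refine eq_cauchySolution (fun i j h => hu (Units.ext (hinj h)))
      (fun i => ((P.u i).isUnit.map (algebraMap S K)).ne_zero) huK fun i => ?_
    -- Interpolating the constant polynomial 1 writes ρ⁻¹ as a sum over the nodes; this becomes the
    -- i-th Cauchy equation.
    have h1 := functional_eq_sum (K := K) hu
      (braidFunctional_cycPoly_mul (P := P) (b := b) (v₀ := v₀) i) 1
    rw [braidFunctional_one hb hv] at h1
    have h2 (j : Fin r) : algebraMap S K (braidFunctional P b v₀ i (P.nodePoly j)) /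
        algebraMap S K ((P.nodePoly j).eval (P.u j : S)) = algebraMap S K P.z *
        (x j / (algebraMap S K (P.u i) * algebraMap S K (P.u j) - 1) -
          if j = i then 1 / (algebraMap S K (P.u i) ^ 2 - 1) else 0) := by
      have h3 := mul_braidFunctional_X_mul hb hv i (P.nodePoly j)
      -- Modulo the cyclotomic polynomial, the node polynomial is an eigenvector of multiplication
      -- by X, with eigenvalue u_j.
      have h4 : braidFunctional P b v₀ i (X * P.nodePoly j) =
          P.u j * braidFunctional P b v₀ i (P.nodePoly j) := by
        have h5 := braidFunctional_cycPoly_mul (P := P) (b := b) (v₀ := v₀) i 1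
        rw [mul_one, ← P.nodePoly_mul j, mul_sub, map_sub, sub_eq_zero, mul_comm _ (C _),
          ← smul_eq_C_mul, map_smul, mul_comm] at h5
        exact h5
      rw [h4] at h3
      have h6 := congrArg (algebraMap S K) h3
      simp only [map_mul, map_add, map_sub] at h6
      have hne := sub_ne_zero.mpr (huK i j)
      have hw0 : algebraMap S K ((P.nodePoly j).eval (P.u j : S)) ≠ 0 :=
        (map_ne_zero_iff _ hinj).mpr (eval_nodePoly_self_ne_zero hu j)
      have key {t A w D d : K} (ht : t - 1 ≠ 0) (hw : w ≠ 0)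
          (h : t * A = A - algebraMap S K P.z * (w * d) + algebraMap S K P.z * D) :
          A / w = algebraMap S K P.z * (D / w / (t - 1) - d / (t - 1)) := by
        field_simp
        linear_combination h
      split_ifs with hij
      · subst hij
        rw [sq]
        exact key hne hw0 (by linear_combination h6)
      · rw [P.eval_nodePoly_of_ne (Ne.symm hij), map_zero] at h6
        rw [← zero_div (algebraMap S K (P.u i) * algebraMap S K (P.u j) - 1)]
        exact key hne hw0 (by linear_combination h6)
    simp only [h2, eval_one, map_one, mul_one] at h1
    rw [← Finset.mul_sum, Finset.sum_sub_distrib, Finset.sum_ite_eq' Finset.univ i,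
      if_pos (Finset.mem_univ i)] at h1
    rw [hc, h1, mul_div_cancel_left₀ _ hz]
    ring
  have h := functional_eq_sum (K := K) hu hw.deltaFunctional_cycPoly_mul (X ^ a)
  rw [deltaFunctional_X_pow] at h
  rw [h]
  refine Finset.sum_congr rfl fun j _ => ?_
  rw [gamma_eq_cauchySolution, ← hc, ← hxs, eval_pow, eval_X, map_pow]

end Gamma

end GroundParams

/-! ### The matrix model of g and e on an eigenbasis of y. -/

section CauchyMatrix

variable {K ι : Type*} [Field K] [Fintype ι] [DecidableEq ι]

/-- The matrix `z (γ_j - δ_{ij}) / (u_i u_j - 1)`, the action of `g` on an eigenbasis of `y_1`. -/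
def braidMatrix (u γ : ι → K) (z : K) : Matrix ι ι K :=
  Matrix.of fun i j => z * (γ j - if i = j then 1 else 0) / (u i * u j - 1)

/-- The matrix all of whose rows are `γ`. -/
def rowMatrix (γ : ι → K) : Matrix ι ι K := Matrix.of fun _ j => γ j

variable {u γ : ι → K} {z ρ : K}

omit [Fintype ι] in
theorem braidMatrix_apply (i j : ι) :
    braidMatrix u γ z i j = z * (γ j - if i = j then 1 else 0) / (u i * u j - 1) := rfl

omit [Fintype ι] in
-- Symmetry of diag(γ) g; it turns row identities for g into column identities.
theorem mul_braidMatrix_comm (i j : ι) :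
    γ i * braidMatrix u γ z i j = γ j * braidMatrix u γ z j i := by
  rw [braidMatrix_apply, braidMatrix_apply, mul_comm (u j)]
  rcases eq_or_ne i j with rfl | h
  · rfl
  · rw [if_neg h, if_neg h.symm]
    ring

variable (huu : ∀ i j, u i * u j ≠ 1)
  (hs : ∀ i, ∑ j, γ j / (u i * u j - 1) = 1 / (u i ^ 2 - 1) + ρ⁻¹ / z)
  (hρ : ρ⁻¹ - ρ = -z * (∑ j, γ j - 1))

include huu in
omit [Fintype ι] in
theorem mul_braidMatrix_mul (i j : ι) :
    u i * braidMatrix u γ z i j * u j =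
      braidMatrix u γ z i j + z * (γ j - if i = j then 1 else 0) := by
  rw [braidMatrix_apply]
  have := sub_ne_zero.mpr (huu i j)
  field_simp
  ring

include hs in
theorem sum_braidMatrix (hz : z ≠ 0) (i : ι) : ∑ j, braidMatrix u γ z i j = ρ⁻¹ := by
  have h (j : ι) : braidMatrix u γ z i j =
      z * (γ j / (u i * u j - 1) - if i = j then 1 / (u i ^ 2 - 1) else 0) := by
    rw [braidMatrix_apply]
    split_ifs with h
    · subst h
      rw [sq]
      ring
    · ring
  simp only [h]
  rw [← Finset.mul_sum, Finset.sum_sub_distrib, hs, Finset.sum_ite_eq Finset.univ i,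
    if_pos (Finset.mem_univ i)]
  field_simp
  ring

include huu hs hρ in
-- Row sums of ygy = g - z(1 - e): they equal ρ⁻¹ + z(∑ γ_j - 1), which is ρ by the ground relation.
theorem mul_sum_braidMatrix_mul (hz : z ≠ 0) (i : ι) :
    u i * ∑ j, braidMatrix u γ z i j * u j = ρ := by
  simp only [Finset.mul_sum, ← mul_assoc, mul_braidMatrix_mul huu]
  rw [Finset.sum_add_distrib, sum_braidMatrix hs hz, ← Finset.mul_sum, Finset.sum_sub_distrib,
    Finset.sum_ite_eq Finset.univ i, if_pos (Finset.mem_univ i)]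
  linear_combination hρ

include hs in
theorem sum_mul_braidMatrix (hz : z ≠ 0) (j : ι) :
    ∑ i, γ i * braidMatrix u γ z i j = ρ⁻¹ * γ j := by
  simp only [fun i => mul_braidMatrix_comm (u := u) (γ := γ) (z := z) i j]
  rw [← Finset.mul_sum, sum_braidMatrix hs hz, mul_comm]

include huu hs hρ in
theorem sum_mul_braidMatrix_mul (hz : z ≠ 0) (j : ι) :
    ∑ i, γ i * u i * braidMatrix u γ z i j * u j = ρ * γ j := by
  have h (i : ι) : γ i * u i * braidMatrix u γ z i j * u j =
      γ j * (u j * (braidMatrix u γ z j i * u i)) := by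
    linear_combination u i * u j * mul_braidMatrix_comm (u := u) (γ := γ) (z := z) i j
  simp only [h]
  rw [← Finset.mul_sum, ← Finset.mul_sum, mul_sum_braidMatrix_mul huu hs hρ hz, mul_comm]

include huu hs in
-- A partial fraction decomposition in u_k reduces the sum to the difference of the Cauchy equations
-- for i and j, in which ρ⁻¹/z cancels.
theorem sum_braidMatrix_mul_braidMatrix_of_ne (hu : Function.Injective u) {i j : ι} (hij : i ≠ j) :
    ∑ k, braidMatrix u γ z i k * u k * braidMatrix u γ z k j = 0 := by
  have hne (i j : ι) : u i * u j - 1 ≠ 0 := sub_ne_zero.mpr (huu i j)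
  have hd : u j - u i ≠ 0 := sub_ne_zero.mpr fun h => hij (hu h).symm
  have h (k : ι) : braidMatrix u γ z i k * u k * braidMatrix u γ z k j =
      z ^ 2 / (u j - u i) * (γ j * (γ k / (u i * u k - 1) - γ k / (u j * u k - 1)) -
        (if i = k then γ j * (1 / (u i * u i - 1) - 1 / (u i * u j - 1)) else 0) -
        (if k = j then γ j * (1 / (u i * u j - 1) - 1 / (u j * u j - 1)) else 0)) := by
    have h1 : u k / ((u i * u k - 1) * (u k * u j - 1)) =
        (1 / (u i * u k - 1) - 1 / (u j * u k - 1)) / (u j - u i) := by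
      have h2 := hne i k
      have h3 := hne j k
      rw [mul_comm (u k) (u j), div_sub_div _ _ h2 h3, div_div,
        div_eq_div_iff (mul_ne_zero h2 h3) (mul_ne_zero (mul_ne_zero h2 h3) hd)]
      ring
    calc braidMatrix u γ z i k * u k * braidMatrix u γ z k j =
        z ^ 2 * ((γ k - if i = k then 1 else 0) * (γ j - if k = j then 1 else 0)) *
          (u k / ((u i * u k - 1) * (u k * u j - 1))) := by
          rw [braidMatrix_apply, braidMatrix_apply]
          have h2 := hne i k
          have h3 := hne k j
          field_simp
      _ = _ := by
          rw [h1]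
          rcases eq_or_ne i k with rfl | hik
          · rw [if_pos rfl, if_pos rfl, if_neg hij, if_neg hij, mul_comm (u j) (u i)]
            ring
          · rw [if_neg hik, if_neg hik]
            split_ifs with hkj
            · subst hkj
              ring
            · ring
  simp only [h]
  rw [← Finset.mul_sum, Finset.sum_sub_distrib, Finset.sum_sub_distrib,
    Finset.sum_ite_eq Finset.univ i, if_pos (Finset.mem_univ i),
    Finset.sum_ite_eq' Finset.univ j, if_pos (Finset.mem_univ j), ← Finset.mul_sum,
    Finset.sum_sub_distrib, hs, hs]
  ring

include huu in
theorem diagonal_mul_braidMatrix_mul_diagonal :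
    Matrix.diagonal u * braidMatrix u γ z * Matrix.diagonal u =
      braidMatrix u γ z - z • (1 - rowMatrix γ) := by
  ext i j
  rw [Matrix.mul_diagonal, Matrix.diagonal_mul, mul_braidMatrix_mul huu, Matrix.sub_apply,
    Matrix.smul_apply, Matrix.sub_apply, Matrix.one_apply, rowMatrix, Matrix.of_apply, smul_eq_mul]
  ring

include huu hs hρ in
-- The diagonal entries need no computation: off the diagonal the product vanishes, and its row sums
-- are ρ⁻¹ρ = 1.
theorem braidMatrix_mul_diagonal_mul_braidMatrix_mul_diagonal (hz : z ≠ 0) (hρ0 : ρ ≠ 0)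
    (hu : Function.Injective u) :
    braidMatrix u γ z * (Matrix.diagonal u * braidMatrix u γ z * Matrix.diagonal u) = 1 := by
  set T := braidMatrix u γ z * (Matrix.diagonal u * braidMatrix u γ z * Matrix.diagonal u) with hT
  have hne {i j : ι} (hij : i ≠ j) : T i j = 0 := by
    rw [hT, ← Matrix.mul_assoc, Matrix.mul_diagonal, ← Matrix.mul_assoc, Matrix.mul_apply]
    simp only [Matrix.mul_diagonal]
    rw [sum_braidMatrix_mul_braidMatrix_of_ne huu hs hu hij, zero_mul]
  have hrow (i : ι) : ∑ j, T i j = 1 := by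
    simp only [hT, Matrix.mul_apply (M := braidMatrix u γ z), Matrix.mul_diagonal,
      Matrix.diagonal_mul]
    rw [Finset.sum_comm]
    simp only [← Finset.mul_sum, mul_assoc, mul_sum_braidMatrix_mul huu hs hρ hz]
    rw [← Finset.sum_mul, sum_braidMatrix hs hz, inv_mul_cancel₀ hρ0]
  ext i j
  rcases eq_or_ne i j with rfl | hij
  · rw [Matrix.one_apply_eq, ← hrow i, Finset.sum_eq_single i (fun j _ h => hne h.symm)
      (fun h => absurd (Finset.mem_univ i) h)]
  · rw [Matrix.one_apply_ne hij, hne hij]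

theorem rowMatrix_mul_diagonal_pow_mul_rowMatrix (k : ℕ) :
    rowMatrix γ * Matrix.diagonal u ^ k * rowMatrix γ = (∑ j, γ j * u j ^ k) • rowMatrix γ := by
  ext i j
  rw [Matrix.diagonal_pow, Matrix.mul_apply, Matrix.smul_apply, smul_eq_mul, Finset.sum_mul]
  simp [Matrix.mul_diagonal, rowMatrix]

include hs in
theorem braidMatrix_mul_rowMatrix (hz : z ≠ 0) :
    braidMatrix u γ z * rowMatrix γ = ρ⁻¹ • rowMatrix γ := by
  ext i j
  rw [Matrix.mul_apply, Matrix.smul_apply]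
  simp only [rowMatrix, Matrix.of_apply]
  rw [← Finset.sum_mul, sum_braidMatrix hs hz, smul_eq_mul]

include hs in
theorem rowMatrix_mul_braidMatrix (hz : z ≠ 0) :
    rowMatrix γ * braidMatrix u γ z = ρ⁻¹ • rowMatrix γ := by
  ext i j
  rw [Matrix.mul_apply, Matrix.smul_apply]
  simp only [rowMatrix, Matrix.of_apply]
  rw [sum_mul_braidMatrix hs hz, smul_eq_mul]

include huu hs hρ in
theorem diagonal_mul_braidMatrix_mul_diagonal_mul_rowMatrix (hz : z ≠ 0) :
    Matrix.diagonal u * braidMatrix u γ z * Matrix.diagonal u * rowMatrix γ =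
      ρ • rowMatrix γ := by
  ext i j
  rw [Matrix.mul_apply, Matrix.smul_apply]
  simp only [rowMatrix, Matrix.of_apply, Matrix.mul_diagonal, Matrix.diagonal_mul]
  rw [← Finset.sum_mul, smul_eq_mul, ← mul_sum_braidMatrix_mul huu hs hρ hz i, Finset.mul_sum]
  simp only [mul_assoc]

include huu hs hρ in
theorem rowMatrix_mul_diagonal_mul_braidMatrix_mul_diagonal (hz : z ≠ 0) :
    rowMatrix γ * Matrix.diagonal u * braidMatrix u γ z * Matrix.diagonal u =
      ρ • rowMatrix γ := by
  ext i j
  rw [Matrix.mul_diagonal, Matrix.mul_apply, Matrix.smul_apply, Finset.sum_mul]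
  simp only [rowMatrix, Matrix.of_apply, Matrix.mul_diagonal]
  rw [sum_mul_braidMatrix_mul huu hs hρ hz, smul_eq_mul]

include huu in
-- The form F(a, b) = ∑ γ_i u_i^a g_ij u_j^b changes in a controlled way under a diagonal step,
-- because u_i g_ij u_j = g_ij + z(γ_j - δ_ij) with Kronecker δ_ij.
theorem sum_zpow_braidMatrix_succ (hu0 : ∀ i, u i ≠ 0) (a b : ℤ) :
    ∑ i, ∑ j, γ i * u i ^ (a + 1) * braidMatrix u γ z i j * u j ^ (b + 1) =
      ∑ i, ∑ j, γ i * u i ^ a * braidMatrix u γ z i j * u j ^ b -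
        z * (∑ i, γ i * u i ^ (a + b) - (∑ i, γ i * u i ^ a) * ∑ i, γ i * u i ^ b) := by
  have h (i j : ι) : γ i * u i ^ (a + 1) * braidMatrix u γ z i j * u j ^ (b + 1) =
      γ i * u i ^ a * braidMatrix u γ z i j * u j ^ b -
        z * ((if i = j then γ i * u i ^ (a + b) else 0) -
          (γ i * u i ^ a) * (γ j * u j ^ b)) := by
    rw [zpow_add_one₀ (hu0 i), zpow_add_one₀ (hu0 j)]
    have h1 := mul_braidMatrix_mul (γ := γ) (z := z) huu i j
    split_ifs at h1 ⊢ with hij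
    · subst hij
      rw [zpow_add₀ (hu0 i)]
      linear_combination (γ i * u i ^ a * u i ^ b) * h1
    · linear_combination (γ i * u i ^ a * u j ^ b) * h1
  simp only [h, Finset.sum_sub_distrib, ← Finset.mul_sum, Finset.sum_ite_eq, Finset.mem_univ,
    if_true, ← Finset.sum_mul]

include huu in
theorem sum_zpow_braidMatrix_add_nat (hu0 : ∀ i, u i ≠ 0) (n : ℕ) (b : ℤ) :
    ∑ i, ∑ j, γ i * u i ^ (n : ℤ) * braidMatrix u γ z i j * u j ^ (b + n) =
      ∑ i, ∑ j, γ i * braidMatrix u γ z i j * u j ^ b -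
        z * ∑ k ∈ Finset.range n, (∑ i, γ i * u i ^ (2 * (k : ℤ) + b) -
          (∑ i, γ i * u i ^ (k : ℤ)) * ∑ i, γ i * u i ^ ((k : ℤ) + b)) := by
  induction n with
  | zero => simp
  | succ n ih =>
    rw [Finset.sum_range_succ, Nat.cast_succ, ← add_assoc b, sum_zpow_braidMatrix_succ huu hu0, ih,
      add_comm b, show (2 * (n : ℤ) + b) = n + (n + b) by ring]
    ring

include huu hs hρ in
-- Walk diagonally from F(0, -(n+1)) to F(n+1, 0). The column and row sums of g evaluate the
-- endpoints as ρ⁻¹ times power sums, so the telescoped steps give the recursion that defines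
-- δ_{-(n+1)}.
theorem sum_zpow_neg (hz : z ≠ 0) (hρ0 : ρ ≠ 0) (hu0 : ∀ i, u i ≠ 0) (n : ℕ) :
    ∑ i, γ i * u i ^ (-((n + 1 : ℕ) : ℤ)) = ρ⁻¹ ^ 2 * ∑ i, γ i * u i ^ ((n + 1 : ℕ) : ℤ) +
      (-z) * ρ⁻¹ * ∑ k ∈ Finset.Icc 1 n,
        ((∑ i, γ i * u i ^ (k : ℤ)) * (∑ i, γ i * u i ^ ((k : ℤ) - (n + 1 : ℕ))) -
          ∑ i, γ i * u i ^ (2 * (k : ℤ) - (n + 1 : ℕ))) := by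
  have h := sum_zpow_braidMatrix_add_nat (γ := γ) (z := z) huu hu0 (n + 1) (-((n + 1 : ℕ) : ℤ))
  simp only [neg_add_cancel, zpow_zero, mul_one, ← Finset.mul_sum, sum_braidMatrix hs hz] at h
  rw [Finset.sum_comm (s := Finset.univ) (t := Finset.univ)] at h
  simp only [← Finset.sum_mul, sum_mul_braidMatrix hs hz, mul_assoc ρ⁻¹] at h
  -- The k = 0 term is split off: it is a multiple of the unknown negative power sum, and the ground
  -- relation merges it with ρ⁻¹ into ρ.
  rw [← Finset.mul_sum, Finset.range_eq_Ico, Finset.sum_eq_sum_Ico_succ_bot n.succ_pos,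
    Nat.cast_zero, mul_zero, zero_add, zero_add, Nat.succ_eq_add_one, Finset.Ico_add_one_right_eq_Icc] at h
  simp only [zpow_zero, mul_one, ← sub_eq_add_neg] at h
  have h2 : ∑ k ∈ Finset.Icc 1 n,
        ((∑ i, γ i * u i ^ (k : ℤ)) * (∑ i, γ i * u i ^ ((k : ℤ) - (n + 1 : ℕ))) -
          ∑ i, γ i * u i ^ (2 * (k : ℤ) - (n + 1 : ℕ))) =
      - ∑ k ∈ Finset.Icc 1 n, (∑ i, γ i * u i ^ (2 * (k : ℤ) - (n + 1 : ℕ)) -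
        (∑ i, γ i * u i ^ (k : ℤ)) * (∑ i, γ i * u i ^ ((k : ℤ) - (n + 1 : ℕ)))) := by
    rw [← Finset.sum_neg_distrib]
    exact Finset.sum_congr rfl fun k _ => (neg_sub _ _).symm
  rw [h2]
  set E := ∑ i, γ i * u i ^ (-((n + 1 : ℕ) : ℤ))
  linear_combination (-ρ⁻¹) * h - ρ⁻¹ * E * hρ - E * inv_mul_cancel₀ hρ0

end CauchyMatrix

/-! ### The representation of W_2 over K and its consequences. -/

namespace GroundParams

section Representation

variable {S : Type*} [CommRing S] {K : Type*} [Field K] [Algebra S K] {r : ℕ}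
  (P : GroundParams S r)

/-- The values on the generators of the representation of `W_2` on an eigenbasis of `y_1`. -/
noncomputable def genMatrix (γ : Fin r → K) : BMWGen 2 → Matrix (Fin r) (Fin r) K
  | .y => Matrix.diagonal fun i => algebraMap S K (P.u i)
  | .yInv => Matrix.diagonal fun i => (algebraMap S K (P.u i))⁻¹
  | .g _ => braidMatrix (fun i => algebraMap S K (P.u i)) γ (algebraMap S K P.z)
  | .gInv _ => Matrix.diagonal (fun i => algebraMap S K (P.u i)) *
      braidMatrix (fun i => algebraMap S K (P.u i)) γ (algebraMap S K P.z) *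
      Matrix.diagonal fun i => algebraMap S K (P.u i)
  | .e _ => rowMatrix γ

variable {P} {γ : Fin r → K}

theorem algebraMap_u_ne_zero (i : Fin r) : algebraMap S K (P.u i) ≠ 0 :=
  ((P.u i).isUnit.map (algebraMap S K)).ne_zero

theorem algebraMap_ρ_ne_zero : algebraMap S K P.ρ ≠ 0 :=
  (P.ρ.isUnit.map (algebraMap S K)).ne_zero

theorem algebraMap_relation (hδ : algebraMap S K (P.δ 0) = ∑ j, γ j) :
    (algebraMap S K P.ρ)⁻¹ - algebraMap S K P.ρ = -algebraMap S K P.z * (∑ j, γ j - 1) := by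
  have h := congrArg (algebraMap S K) P.relation
  rw [map_sub, map_mul, map_sub, map_sub, map_one, algebraMap_unit_inv, hδ] at h
  rw [h, z, map_sub]
  ring

theorem prod_ofFn_diagonal_sub_algebraMap : (List.ofFn fun k : Fin r =>
    Matrix.diagonal (fun i => algebraMap S K (P.u i)) -
      algebraMap S (Matrix (Fin r) (Fin r) K) (P.u k : S)).prod = 0 := by
  have h (k : Fin r) : Matrix.diagonal (fun i => algebraMap S K (P.u i)) -
      algebraMap S (Matrix (Fin r) (Fin r) K) (P.u k : S) = Matrix.diagonalRingHom (Fin r) K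
        (fun i => algebraMap S K (P.u i) - algebraMap S K (P.u k)) := by
    rw [Matrix.algebraMap_eq_diagonal, Matrix.diagonal_sub]
    rfl
  simp only [h]
  change (List.ofFn (Matrix.diagonalRingHom (Fin r) K ∘ _)).prod = 0
  rw [← List.map_ofFn, ← map_list_prod, List.prod_ofFn]
  convert map_zero (Matrix.diagonalRingHom (Fin r) K)
  funext i
  rw [Finset.prod_apply]
  exact Finset.prod_eq_zero (Finset.mem_univ i) (sub_self _)

/-- Since g⁻¹ is represented by ygy, the skein relation is an entrywise identity. Relations with two
adjacent or far indices, or a positive index, are vacuous on two strands. -/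
theorem lift_genMatrix_eq_of_BMWRel (hz : algebraMap S K P.z ≠ 0)
    (hu : Function.Injective fun i => algebraMap S K (P.u i))
    (huu : ∀ i j, algebraMap S K (P.u i) * algebraMap S K (P.u j) ≠ 1)
    (hs : ∀ i, ∑ j, γ j / (algebraMap S K (P.u i) * algebraMap S K (P.u j) - 1) =
      1 / (algebraMap S K (P.u i) ^ 2 - 1) + (algebraMap S K P.ρ)⁻¹ / algebraMap S K P.z)
    (hδ : ∀ a : ℕ, algebraMap S K (P.δ a) = ∑ j, γ j * algebraMap S K (P.u j) ^ a)
    ⦃a b : FreeAlgebra S (BMWGen 2)⦄ (h : P.BMWRel 2 a b) :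
    FreeAlgebra.lift S (P.genMatrix γ) a = FreeAlgebra.lift S (P.genMatrix γ) b := by
  have hρ := algebraMap_relation (P := P) (γ := γ) (by simpa using hδ 0)
  have hinv := braidMatrix_mul_diagonal_mul_braidMatrix_mul_diagonal huu hs hρ hz
    algebraMap_ρ_ne_zero hu
  have hinv' := mul_eq_one_comm.mp hinv
  cases h with
  | g_mul_gInv i => simpa [genMatrix] using hinv
  | gInv_mul_g i => simpa [genMatrix] using hinv'
  | y_mul_yInv => simp [genMatrix, algebraMap_u_ne_zero]
  | yInv_mul_y => simp [genMatrix, algebraMap_u_ne_zero]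
  | e_sq i =>
    have := rowMatrix_mul_diagonal_pow_mul_rowMatrix (u := fun i => algebraMap S K (P.u i))
      (γ := γ) 0
    rw [← hδ, algebraMap_smul] at this
    simpa [genMatrix] using this
  | braid i j h => omega
  | g_comm i j h => unfold BMWGen.Far at h; omega
  | braid_y i h =>
    simp only [map_mul, FreeAlgebra.lift_ι_apply, genMatrix]
    -- Both sides of the braid relation are the identity matrix.
    rw [hinv', ← hinv]
    simp only [mul_assoc]
  | y_g_comm j h => omega
  | g_e_comm i j h => unfold BMWGen.Far at h; omega
  | e_comm i j h => unfold BMWGen.Far at h; omega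
  | y_e_comm j h => omega
  | e_e_e i j h => unfold BMWGen.Adjacent at h; omega
  | g_g_e i j h => unfold BMWGen.Adjacent at h; omega
  | e_g_g i j h => unfold BMWGen.Adjacent at h; omega
  | e_y_pow_e i h k hk =>
    have := rowMatrix_mul_diagonal_pow_mul_rowMatrix (u := fun i => algebraMap S K (P.u i))
      (γ := γ) k
    rw [← hδ, algebraMap_smul] at this
    simpa only [map_mul, map_pow, map_smul, FreeAlgebra.lift_ι_apply, genMatrix] using this
  | skein i =>
    simp only [map_sub, map_smul, map_one, FreeAlgebra.lift_ι_apply, genMatrix]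
    rw [diagonal_mul_braidMatrix_mul_diagonal huu, sub_sub_cancel, algebraMap_smul, z]
  | g_e i =>
    have := braidMatrix_mul_rowMatrix hs hz
    rw [← algebraMap_unit_inv, algebraMap_smul] at this
    simpa only [map_mul, map_smul, FreeAlgebra.lift_ι_apply, genMatrix] using this
  | e_g i =>
    have := rowMatrix_mul_braidMatrix hs hz
    rw [← algebraMap_unit_inv, algebraMap_smul] at this
    simpa only [map_mul, map_smul, FreeAlgebra.lift_ι_apply, genMatrix] using this
  | e_g_e i j h => unfold BMWGen.Adjacent at h; omega
  | e_unwrap i h =>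
    have := rowMatrix_mul_diagonal_mul_braidMatrix_mul_diagonal huu hs hρ hz
    rw [algebraMap_smul] at this
    simpa only [map_mul, map_smul, FreeAlgebra.lift_ι_apply, genMatrix] using this
  | unwrap_e i h =>
    have := diagonal_mul_braidMatrix_mul_diagonal_mul_rowMatrix huu hs hρ hz
    rw [algebraMap_smul] at this
    simpa only [map_mul, map_smul, FreeAlgebra.lift_ι_apply, genMatrix] using this
  | cyclotomic =>
    rw [map_list_prod, List.map_ofFn, map_zero, ← prod_ofFn_diagonal_sub_algebraMap (P := P)]
    congr 2
    funext k
    simp [genMatrix]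

theorem exists_representation (hz : algebraMap S K P.z ≠ 0)
    (hu : Function.Injective fun i => algebraMap S K (P.u i))
    (huu : ∀ i j, algebraMap S K (P.u i) * algebraMap S K (P.u j) ≠ 1)
    (hs : ∀ i, ∑ j, γ j / (algebraMap S K (P.u i) * algebraMap S K (P.u j) - 1) =
      1 / (algebraMap S K (P.u i) ^ 2 - 1) + (algebraMap S K P.ρ)⁻¹ / algebraMap S K P.z)
    (hδ : ∀ a : ℕ, algebraMap S K (P.δ a) = ∑ j, γ j * algebraMap S K (P.u j) ^ a) :
    ∃ φ : P.W₂ →ₐ[S] Matrix (Fin r) (Fin r) K,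
      φ P.y₁ = Matrix.diagonal (fun i => algebraMap S K (P.u i)) ∧ φ P.e₁ = rowMatrix γ := by
  refine ⟨RingQuot.liftAlgHom S ⟨FreeAlgebra.lift S (P.genMatrix γ),
    lift_genMatrix_eq_of_BMWRel hz hu huu hs hδ⟩, ?_, ?_⟩ <;>
  simp [y₁, e₁, gen, RingQuot.liftAlgHom_mkAlgHom_apply, genMatrix]

/-- As δ_0 = ∑ γ_j is nonzero, some γ_j is. Entry (i, j) of ∑ c_k y^k e is γ_j ∑ c_k u_i^k, and the
Vandermonde matrix of the u_i is nonsingular. -/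
theorem linearIndependent_of_delta_eq [IsDomain S] [FaithfulSMul S K]
    (hz : algebraMap S K P.z ≠ 0)
    (hu : Function.Injective fun i => algebraMap S K (P.u i))
    (huu : ∀ i j, algebraMap S K (P.u i) * algebraMap S K (P.u j) ≠ 1)
    (hs : ∀ i, ∑ j, γ j / (algebraMap S K (P.u i) * algebraMap S K (P.u j) - 1) =
      1 / (algebraMap S K (P.u i) ^ 2 - 1) + (algebraMap S K P.ρ)⁻¹ / algebraMap S K P.z)
    (hδ : ∀ a : ℕ, algebraMap S K (P.δ a) = ∑ j, γ j * algebraMap S K (P.u j) ^ a) :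
    LinearIndependent S (fun k : Fin r => P.y₁ ^ k.val * P.e₁) := by
  obtain ⟨φ, hy, he⟩ := exists_representation hz hu huu hs hδ
  have hinj := FaithfulSMul.algebraMap_injective S K
  obtain ⟨j, hj⟩ : ∃ j, γ j ≠ 0 := by
    by_contra! h0
    refine (P.isUnit_δ_zero.map (algebraMap S K)).ne_zero ?_
    rw [hδ]
    exact Finset.sum_eq_zero fun j _ => by rw [h0, zero_mul]
  refine LinearIndependent.of_comp φ.toLinearMap (Fintype.linearIndependent_iff.mpr fun c hc => ?_)
  have hc0 : (fun k => algebraMap S K (c k)) = 0 := by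
    refine Matrix.eq_zero_of_forall_index_sum_mul_pow_eq_zero hu fun i => ?_
    have h := congrFun (congrFun hc i) j
    rw [Matrix.sum_apply] at h
    refine (mul_eq_zero.mp ?_).resolve_right hj
    rw [Finset.sum_mul, ← Matrix.zero_apply (α := K) i j, ← h]
    refine Finset.sum_congr rfl fun k _ => ?_
    simp [hy, he, Matrix.diagonal_pow, rowMatrix, Algebra.smul_def, mul_assoc]
  intro k
  exact hinj ((congrFun hc0 k).trans (map_zero _).symm)

theorem algebraMap_deltaInt (hz : algebraMap S K P.z ≠ 0)
    (huu : ∀ i j, algebraMap S K (P.u i) * algebraMap S K (P.u j) ≠ 1)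
    (hs : ∀ i, ∑ j, γ j / (algebraMap S K (P.u i) * algebraMap S K (P.u j) - 1) =
      1 / (algebraMap S K (P.u i) ^ 2 - 1) + (algebraMap S K P.ρ)⁻¹ / algebraMap S K P.z)
    (hδ : ∀ a : ℕ, algebraMap S K (P.δ a) = ∑ j, γ j * algebraMap S K (P.u j) ^ a) (a : ℤ) :
    algebraMap S K (P.deltaInt a) = ∑ j, γ j * algebraMap S K (P.u j) ^ a := by
  have hnat (n : ℕ) : algebraMap S K (P.deltaInt n) =
      ∑ j, γ j * algebraMap S K (P.u j) ^ (n : ℤ) := by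
    rw [deltaInt_natCast, hδ]
    simp only [zpow_natCast]
  -- The recursion for δ_{-(n+1)} involves only indices at least -n, since its summation starts at k
  -- = 1; hence induction on a lower bound for a.
  suffices h : ∀ (n : ℕ) (a : ℤ), -(n : ℤ) ≤ a → algebraMap S K (P.deltaInt a) =
      ∑ j, γ j * algebraMap S K (P.u j) ^ a from h a.natAbs a (by omega)
  intro n
  induction n with
  | zero =>
    intro a ha
    obtain ⟨m, rfl⟩ := Int.eq_ofNat_of_zero_le (a := a) (by simpa using ha)
    exact hnat m
  | succ n ih =>
    intro a ha
    rcases eq_or_lt_of_le ha with rfl | h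
    · rw [deltaInt_neg P (n + 1) (by omega), sum_zpow_neg huu hs
        (algebraMap_relation (by simpa using hδ 0)) hz algebraMap_ρ_ne_zero algebraMap_u_ne_zero,
        map_add, map_mul, map_pow, hnat, algebraMap_unit_inv, map_mul, map_mul, map_sum,
        algebraMap_unit_inv, Nat.add_sub_cancel]
      congr 1
      congr 1
      · rw [← map_neg, z, neg_sub]
      · refine Finset.sum_congr rfl fun k hk => ?_
        have hk1 := (Finset.mem_Icc.mp hk).1
        rw [map_sub, map_mul, hnat, ih _ (by push_cast; omega), ih _ (by push_cast; omega)]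
    · exact ih a (by push_cast at h; omega)

/-- Once δ_a = ∑ γ_j u_j^a for all integers a, the admissibility sum is ∑ γ_j u_j^a times the
cyclotomic polynomial at u_j, which is zero. -/
theorem weaklyAdmissible_of_delta_eq [FaithfulSMul S K] (hz : algebraMap S K P.z ≠ 0)
    (huu : ∀ i j, algebraMap S K (P.u i) * algebraMap S K (P.u j) ≠ 1)
    (hs : ∀ i, ∑ j, γ j / (algebraMap S K (P.u i) * algebraMap S K (P.u j) - 1) =
      1 / (algebraMap S K (P.u i) ^ 2 - 1) + (algebraMap S K P.ρ)⁻¹ / algebraMap S K P.z)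
    (hδ : ∀ a : ℕ, algebraMap S K (P.δ a) = ∑ j, γ j * algebraMap S K (P.u j) ^ a) :
    P.WeaklyAdmissible := by
  have hinj := FaithfulSMul.algebraMap_injective S K
  have : Nontrivial S := by
    refine ⟨P.z, 0, fun h => hz ?_⟩
    rw [h, map_zero]
  intro a
  apply hinj
  rw [map_sum, map_zero]
  calc _ = ∑ k ∈ Finset.range (r + 1), ∑ j, γ j * algebraMap S K (P.u j) ^ a *
        algebraMap S K (P.cycPoly.coeff k * (P.u j : S) ^ k) := by
        refine Finset.sum_congr rfl fun k hk => ?_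
        rw [← P.coeff_cycPoly (Nat.lt_succ_iff.mp (Finset.mem_range.mp hk)), map_mul,
          algebraMap_deltaInt hz huu hs hδ, Finset.mul_sum]
        refine Finset.sum_congr rfl fun j _ => ?_
        rw [zpow_add₀ (algebraMap_u_ne_zero j), zpow_natCast, map_mul, map_pow]
        ring
    _ = 0 := by
        rw [Finset.sum_comm]
        refine Finset.sum_eq_zero fun j _ => ?_
        rw [← Finset.mul_sum, ← map_sum, ← Polynomial.eval_eq_sum_range' (by
          rw [P.natDegree_cycPoly]; exact r.lt_succ_self), P.eval_cycPoly, map_zero, mul_zero]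

end Representation
end GroundParams

theorem mainTheorem6 {S : Type*} [CommRing S] [IsDomain S] {K : Type*} [Field K] [Algebra S K]
    [IsFractionRing S K] {r : ℕ} (P : GroundParams S r)
    (hq : (P.q : S) - ((P.q⁻¹ : Sˣ) : S) ≠ 0)
    (hu : Function.Injective P.u)
    (huu : ∀ i j : Fin r, (P.u i : S) * (P.u j : S) ≠ 1) :
    List.TFAE [
      P.WeaklyAdmissible ∧ LinearIndependent S (fun k : Fin r => P.y₁ ^ k.val * P.e₁),
      ∀ a : ℕ, algebraMap S K (P.δ a) =
        ∑ j : Fin r, P.gamma K j * algebraMap S K (P.u j) ^ a,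
      P.WeaklyAdmissible ∧ P.HasCyclicModule] := by
  have hinj : Function.Injective (algebraMap S K) := IsFractionRing.injective S K
  have : FaithfulSMul S K := (faithfulSMul_iff_algebraMap_injective S K).mpr hinj
  tfae_have 1 → 3 := fun h => ⟨h.1, P.hasCyclicModule_of_linearIndependent h.2⟩
  tfae_have 3 → 2 := fun h => GroundParams.delta_eq_of_hasCyclicModule hq hu huu h.1 h.2
  tfae_have 2 → 1 := by
    intro hδ
    have hz : algebraMap S K P.z ≠ 0 := (map_ne_zero_iff _ hinj).mpr hq
    have huK : Function.Injective fun i => algebraMap S K (P.u i) :=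
      fun i j h => hu (Units.ext (hinj h))
    have huuK (i j : Fin r) : algebraMap S K (P.u i) * algebraMap S K (P.u j) ≠ 1 := by
      rw [← map_mul, Ne, ← map_one (algebraMap S K), hinj.eq_iff]
      exact huu i j
    have hs (i : Fin r) : ∑ j, P.gamma K j /
        (algebraMap S K (P.u i) * algebraMap S K (P.u j) - 1) =
        1 / (algebraMap S K (P.u i) ^ 2 - 1) + (algebraMap S K P.ρ)⁻¹ / algebraMap S K P.z := by
      simp only [P.gamma_eq_cauchySolution]
      rw [sum_cauchySolution_div huK huuK, GroundParams.algebraMap_unit_inv]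
    exact ⟨GroundParams.weaklyAdmissible_of_delta_eq hz huuK hs hδ,
      GroundParams.linearIndependent_of_delta_eq hz huK huuK hs hδ⟩
  tfae_finish
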